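/- All logarithms are to base $2$, and all random variables take values in finite sets. A channel $F:X\to Y$ with input alphabet $\{0,1\}$ and output alphabet $\{k\in\mathbb Z:-l\le k\le l\}$ (for some integer $l\ge 0$) is called BISO (binary-input symmetric-output) if $P(Y=k\mid X=0)=P(Y=-k\mid X=1)$ for all $-l\le k\le l$. Its capacity is $\max_{p(x)} I(X;Y)$. A channel $F_1:X\to Y_1$ is more capable than $F_2:X\to Y_2$ if $I(X;Y_1)\ge I(X;Y_2)$ for every input distribution $p(x)$, and two channels are more-capable comparable if one of them is more capable than the other. For two channels $F_1:X\to Y_1$ and $F_2:X\to Y_2$ with capacities $C_1,C_2$, define the following sets of pairs $(R_1,R_2)$ with $R_1,R_2\ge 0$. * $TD$ (time-division region): the pairs with $R_1\le\alpha C_1$ and $R_2\le(1-\alpha)C_2$ for some $\alpha\in[0,1]$. * $MIB$ (Marton's inner bound): the pairs with $$R_1\le I(U,W;Y_1),\qquad R_2\le I(V,W;Y_2),$$ $$R_1+R_2\le\min\{I(W;Y_1),I(W;Y_2)\}+I(U;Y_1|W)+I(V;Y_2|W)-I(U;V|W)$$ for some random variables $(U,V,W,X)$ such that $(U,V,W)\to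 X\to(Y_1,Y_2)$ is a Markov chain. * $OB$ (outer bound): the pairs with $$R_1\le I(U;Y_1),\qquad R_2\le I(V;Y_2),$$ $$R_1+R_2\le I(U;Y_1)+I(X;Y_2|U),\qquad R_1+R_2\le I(V;Y_2)+I(X;Y_1|V)$$ for some random variables $(U,V,X)$ such that $(U,V)\to X\to(Y_1,Y_2)$ is a Markov chain. For $s\in[0,\tfrac12]$ let $f_i(s)=I(U;Y_i)$, where $X$ is uniform on $\{0,1\}$, $U$ is connected to $X$ by a binary symmetric channel with crossover probability $s$, and $U\to X\to Y_i$ is a Markov chain. Let $$I=\{s\in[0,\tfrac12]: f_1(s)>f_2(s)\},\qquad J=\{s\in[0,\tfrac12]: f_1(s)<f_2(s)\}.$$ **Theorem.** Let $F_1$ and $F_2$ be BISO channels (possibly with different output alphabets) with the same capacity $C$. Then the following are equivalent: (a) $F_1$ and $F_2$ are not more-capable comparable; (b) $TD\subsetneq OB$; (c) there exist $s_1\in I$ and $s_2\in J$ such that $f_1(s_1)+f_2(s_2)>C$; (d) $TD\subsetneq MIB$; (e) $MIB\subsetneq OB$. -/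

import Mathlib

namespace BroadcastBISO

/-! ### Entropy and mutual information of random variables on a finite probability space

A finite probability space is a finite type `Ω` with a weight function `P : Ω → ℝ` that belongs to
`stdSimplex ℝ Ω`; a random variable is a function on `Ω`.  Logarithms are to base two. -/

/-- The probability of the event `Z = a`. -/
def law {Ω A : Type} [Fintype Ω] [DecidableEq A] (P : Ω → ℝ) (Z : Ω → A) (a : A) : ℝ :=
  ∑ ω with Z ω = a, P ω

/-- The Shannon entropy `H(Z)` in bits (with `0 log 0 = 0`). -/
noncomputable def entropy {Ω A : Type} [Fintype Ω] [Fintype A] [DecidableEq A]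
    (P : Ω → ℝ) (Z : Ω → A) : ℝ :=
  -∑ a, law P Z a * Real.logb 2 (law P Z a)

/-- The mutual information `I(Z;Z') = H(Z) + H(Z') - H(Z,Z')`. -/
noncomputable def mutualInfo {Ω A B : Type} [Fintype Ω] [Fintype A] [DecidableEq A]
    [Fintype B] [DecidableEq B] (P : Ω → ℝ) (Z : Ω → A) (Z' : Ω → B) : ℝ :=
  entropy P Z + entropy P Z' - entropy P (fun ω => (Z ω, Z' ω))

/-- The conditional mutual information
`I(Z;Z'|T) = H(Z,T) + H(Z',T) - H(Z,Z',T) - H(T)`. -/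
noncomputable def condMutualInfo {Ω A B D : Type} [Fintype Ω] [Fintype A] [DecidableEq A]
    [Fintype B] [DecidableEq B] [Fintype D] [DecidableEq D]
    (P : Ω → ℝ) (Z : Ω → A) (Z' : Ω → B) (T : Ω → D) : ℝ :=
  entropy P (fun ω => (Z ω, T ω)) + entropy P (fun ω => (Z' ω, T ω))
    - entropy P (fun ω => (Z ω, Z' ω, T ω)) - entropy P T

/-! ### Channels -/

/-- A discrete memoryless channel: `prob x y = P(Y = y | X = x)`. -/
structure DMC (𝒳 𝒴 : Type) [Fintype 𝒴] where
  prob : 𝒳 → 𝒴 → ℝ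
  mem_stdSimplex : ∀ x, prob x ∈ stdSimplex ℝ 𝒴

/-- The output alphabet `{k : -l ≤ k ≤ l}`. -/
abbrev SymAlphabet (l : ℕ) : Type := Finset.Icc (-(l : ℤ)) (l : ℤ)

/-- Binary-input symmetric-output: `P(Y = k | X = 0) = P(Y = -k | X = 1)` for `-l ≤ k ≤ l`. -/
def DMC.IsBISO {l : ℕ} (F : DMC (Fin 2) (SymAlphabet l)) : Prop :=
  ∀ k k' : SymAlphabet l, (k' : ℤ) = -(k : ℤ) → F.prob 0 k = F.prob 1 k'

section Transmission

variable {Ω 𝒳 𝒴 A B : Type} [Fintype Ω] [Fintype 𝒴] [DecidableEq 𝒴]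
  [Fintype A] [DecidableEq A] [Fintype B] [DecidableEq B]

/-- The joint law of `(ω, Y)` when `ω` has law `q`, the channel input is `X ω`, and, given `ω`, the
output `Y` is drawn from `F(· | X ω)`.  In particular `Z → X → Y` is a Markov chain for every random
variable `Z` on `Ω`. -/
def outputLaw (q : Ω → ℝ) (X : Ω → 𝒳) (F : DMC 𝒳 𝒴) : Ω × 𝒴 → ℝ :=
  fun p => q p.1 * F.prob (X p.1) p.2

/-- `I(Z;Y)`, where `Y` is the output of the channel `F` on the input `X`. -/
noncomputable def outInfo (q : Ω → ℝ) (X : Ω → 𝒳) (F : DMC 𝒳 𝒴) (Z : Ω → A) : ℝ :=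
  mutualInfo (outputLaw q X F) (fun p => Z p.1) (fun p => p.2)

/-- `I(Z;Y|T)`, where `Y` is the output of the channel `F` on the input `X`. -/
noncomputable def condOutInfo (q : Ω → ℝ) (X : Ω → 𝒳) (F : DMC 𝒳 𝒴) (Z : Ω → A) (T : Ω → B) : ℝ :=
  condMutualInfo (outputLaw q X F) (fun p => Z p.1) (fun p => p.2) (fun p => T p.1)

end Transmission

section Regions

variable {𝒳 𝒴₁ 𝒴₂ : Type} [Fintype 𝒳] [DecidableEq 𝒳]
  [Fintype 𝒴₁] [DecidableEq 𝒴₁] [Fintype 𝒴₂] [DecidableEq 𝒴₂]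

/-- `I(X;Y)` when the input distribution is `p`. -/
noncomputable def DMC.info (F : DMC 𝒳 𝒴₁) (p : 𝒳 → ℝ) : ℝ := outInfo p id F id

/-- The capacity `max_p I(X;Y)`. -/
noncomputable def DMC.capacity (F : DMC 𝒳 𝒴₁) : ℝ := sSup (F.info '' stdSimplex ℝ 𝒳)

/-- `F₁` is more capable than `F₂`: `I(X;Y₁) ≥ I(X;Y₂)` for every input distribution. -/
def MoreCapable (F₁ : DMC 𝒳 𝒴₁) (F₂ : DMC 𝒳 𝒴₂) : Prop :=
  ∀ p ∈ stdSimplex ℝ 𝒳, F₂.info p ≤ F₁.info p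

/-- One of the two channels is more capable than the other. -/
def MoreCapableComparable (F₁ : DMC 𝒳 𝒴₁) (F₂ : DMC 𝒳 𝒴₂) : Prop :=
  MoreCapable F₁ F₂ ∨ MoreCapable F₂ F₁

/-- The time-division region. -/
def timeDivision (F₁ : DMC 𝒳 𝒴₁) (F₂ : DMC 𝒳 𝒴₂) : Set (ℝ × ℝ) :=
  {R | 0 ≤ R.1 ∧ 0 ≤ R.2 ∧ ∃ α ∈ Set.Icc (0 : ℝ) 1,
    R.1 ≤ α * F₁.capacity ∧ R.2 ≤ (1 - α) * F₂.capacity}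

/-- Marton's inner bound: the union over all finite alphabets for `U, V, W` and all joint laws `q` of
`(U, V, W, X)`.  Only the pairs `(·, Y₁)` and `(·, Y₂)` occur in it, so the two marginal channels of the
broadcast channel determine it. -/
def martonInnerBound (F₁ : DMC 𝒳 𝒴₁) (F₂ : DMC 𝒳 𝒴₂) : Set (ℝ × ℝ) :=
  {R | 0 ≤ R.1 ∧ 0 ≤ R.2 ∧ ∃ (a b c : ℕ) (q : Fin a × Fin b × Fin c × 𝒳 → ℝ),
    q ∈ stdSimplex ℝ (Fin a × Fin b × Fin c × 𝒳) ∧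
    let U : Fin a × Fin b × Fin c × 𝒳 → Fin a := fun ω => ω.1
    let V : Fin a × Fin b × Fin c × 𝒳 → Fin b := fun ω => ω.2.1
    let W : Fin a × Fin b × Fin c × 𝒳 → Fin c := fun ω => ω.2.2.1
    let X : Fin a × Fin b × Fin c × 𝒳 → 𝒳 := fun ω => ω.2.2.2
    R.1 ≤ outInfo q X F₁ (fun ω => (U ω, W ω)) ∧
    R.2 ≤ outInfo q X F₂ (fun ω => (V ω, W ω)) ∧
    R.1 + R.2 ≤ min (outInfo q X F₁ W) (outInfo q X F₂ W)
      + condOutInfo q X F₁ U W + condOutInfo q X F₂ V W - condMutualInfo q U V W}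

/-- The outer bound: the union over all finite alphabets for `U, V` and all joint laws `q` of
`(U, V, X)`. -/
def outerBound (F₁ : DMC 𝒳 𝒴₁) (F₂ : DMC 𝒳 𝒴₂) : Set (ℝ × ℝ) :=
  {R | 0 ≤ R.1 ∧ 0 ≤ R.2 ∧ ∃ (a b : ℕ) (q : Fin a × Fin b × 𝒳 → ℝ),
    q ∈ stdSimplex ℝ (Fin a × Fin b × 𝒳) ∧
    let U : Fin a × Fin b × 𝒳 → Fin a := fun ω => ω.1
    let V : Fin a × Fin b × 𝒳 → Fin b := fun ω => ω.2.1
    let X : Fin a × Fin b × 𝒳 → 𝒳 := fun ω => ω.2.2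
    R.1 ≤ outInfo q X F₁ U ∧
    R.2 ≤ outInfo q X F₂ V ∧
    R.1 + R.2 ≤ outInfo q X F₁ U + condOutInfo q X F₂ X U ∧
    R.1 + R.2 ≤ outInfo q X F₂ V + condOutInfo q X F₁ X V}

end Regions

/-- The joint law of `(U, X)` when `X` is uniform on `{0,1}` and `U → X` is a binary symmetric channel
with crossover probability `s`. -/
noncomputable def bscLaw (s : ℝ) : Fin 2 × Fin 2 → ℝ :=
  fun ω => (1 / 2) * (if ω.2 = ω.1 then 1 - s else s)

/-- `f(s) = I(U;Y)`, where `U → X` is `BSC(s)`, `X` is uniform and `Y` is the output of `F` on `X`. -/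
noncomputable def bscInfo {𝒴 : Type} [Fintype 𝒴] [DecidableEq 𝒴] (F : DMC (Fin 2) 𝒴) (s : ℝ) : ℝ :=
  outInfo (bscLaw s) (fun ω => ω.2) F (fun ω => ω.1)

end BroadcastBISO

namespace BroadcastBISO

open Finset

/-! Write `g_i(s)` for `I(X;Y_i)` when `P(X = 1) = s`. Symmetry makes the uniform input optimal, so
`f_i = C - g_i`, and equality of the capacities makes time division the triangle `R₁ + R₂ ≤ C`. If,
say, `F₁` is more capable, then `I(U;Y₁) + I(X;Y₂|U) ≤ I(X;Y₁) ≤ C`, so the outer bound collapses to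
this triangle, and with it everything in between.

If the channels are not comparable, `g₂ - g₁` takes both signs. Let `d₁`, `d₂` be the maxima of `g₂
- g₁` and `g₁ - g₂`, attained at `t₁`, `t₂`. A cloud centre `W` that uses a BSC at a point where `g₂
> g₁` half of the time and one at a point where `g₁ > g₂` otherwise, with the remaining information
sent to the better receiver, beats `C`; hence Marton's bound exceeds time division. For the outer
bound, `U` and `V` may be chosen independently given `X`, so the two mixing weights need not add up
to one, and sum rates above `C + d₁d₂/(d₁+d₂)` occur.

Marton's bound cannot do that. The core is `martonSumBounded`: `I(U;Y₁) + I(V;Y₂) - I(U;V) ≤ max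
(I(X;Y₁)) (I(X;Y₂))` for binary `X`. Convexity reduces `U` and `V` to two letters, and the
functional representation makes `X` a function of `(U,V)`. If `X` depends on one variable only, this
is data processing; XOR follows from a strong data-processing inequality for each of `X → U`, `X →
V`, with constants that fit together; AND follows from two tangent bounds touching at the same
point.

Condition (c) comes from analyticity: `g₁` and `g₂` differ arbitrarily close to `0`, where both are
small, so one of the two crossing points can be taken there. -/

/-! ### The entropy function -/

/-- The function `t ↦ -t log₂ t`. -/
noncomputable def ent (t : ℝ) : ℝ := Real.negMulLog t / Real.log 2

@[simp] lemma ent_zero : ent 0 = 0 := by simp [ent]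

@[simp] lemma ent_one : ent 1 = 0 := by simp [ent]

lemma ent_eq (t : ℝ) : ent t = -(t * Real.logb 2 t) := by
  simp only [ent, Real.negMulLog, Real.logb]; ring

lemma log_two_pos : 0 < Real.log 2 := Real.log_pos one_lt_two

lemma ent_mul (x y : ℝ) : ent (x * y) = y * ent x + x * ent y := by
  simp only [ent, Real.negMulLog_mul]; ring

lemma continuous_ent : Continuous ent := Real.continuous_negMulLog.div_const _

lemma concaveOn_ent : ConcaveOn ℝ (Set.Ici 0) ent := by
  have h := Real.concaveOn_negMulLog.smul (inv_nonneg.2 log_two_pos.le)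
  refine h.congr fun x _ => ?_
  simp only [ent, smul_eq_mul, div_eq_inv_mul]

/-- Gibbs' inequality for a single term. -/
lemma ent_le_cross {n t : ℝ} (hn : 0 ≤ n) (ht : 0 ≤ t) (h : t = 0 → n = 0) :
    ent n + n * Real.logb 2 t ≤ (t - n) / Real.log 2 := by
  rcases hn.eq_or_lt with rfl | hn'
  · simp; exact div_nonneg ht log_two_pos.le
  have ht' : 0 < t := lt_of_le_of_ne ht fun h0 => hn'.ne' (h h0.symm)
  have h1 := Real.log_le_sub_one_of_pos (div_pos ht' hn')
  rw [Real.log_div ht'.ne' hn'.ne'] at h1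
  have h2 : n * (Real.log t - Real.log n) ≤ t - n := by
    have := mul_le_mul_of_nonneg_left h1 hn
    have e : n * (t / n - 1) = t - n := by field_simp
    linarith
  simp only [ent, Real.negMulLog, Real.logb]
  rw [← mul_div_assoc, ← add_div]
  exact div_le_div_of_nonneg_right (by linarith) log_two_pos.le

/-! ### Nonnegativity of mutual information -/

section MatInfo

variable {A B : Type} [Fintype A] [Fintype B]

/-- The mutual information (up to normalization) of a nonnegative matrix. -/
noncomputable def matInfo (n : A → B → ℝ) : ℝ :=
  ∑ a, ent (∑ b, n a b) + ∑ b, ent (∑ a, n a b) - ∑ a, ∑ b, ent (n a b) - ent (∑ a, ∑ b, n a b)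

lemma matInfo_swap (n : A → B → ℝ) : matInfo (fun b a => n a b) = matInfo n := by
  unfold matInfo
  rw [Finset.sum_comm (f := fun b a => ent (n a b)), Finset.sum_comm (f := fun b a => n a b)]
  ring

/-- Gibbs' inequality, entry by entry, against the product of the marginals `r a * c b / N`, which
has the same total mass `N`. -/
lemma matInfo_nonneg {n : A → B → ℝ} (hn : ∀ a b, 0 ≤ n a b) : 0 ≤ matInfo n := by
  set r : A → ℝ := fun a => ∑ b, n a b with hr
  set c : B → ℝ := fun b => ∑ a, n a b with hc
  set N : ℝ := ∑ a, r a with hN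
  have hNc : N = ∑ b, c b := Finset.sum_comm
  have hr0 : ∀ a, 0 ≤ r a := fun a => sum_nonneg fun b _ => hn a b
  have hc0 : ∀ b, 0 ≤ c b := fun b => sum_nonneg fun a _ => hn a b
  have hN0 : 0 ≤ N := sum_nonneg fun a _ => hr0 a
  have hra : ∀ a b, n a b ≤ r a := fun a b => single_le_sum (fun b _ => hn a b) (mem_univ b)
  have hcb : ∀ a b, n a b ≤ c b := fun a b =>
    single_le_sum (f := fun a => n a b) (fun a _ => hn a b) (mem_univ a)
  have hrN : ∀ a, r a ≤ N := fun a => single_le_sum (fun a _ => hr0 a) (mem_univ a)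
  have key : ∀ a b, ent (n a b) + n a b * (Real.logb 2 (r a) + Real.logb 2 (c b) - Real.logb 2 N)
      ≤ (r a * c b / N - n a b) / Real.log 2 := by
    intro a b
    rcases (hn a b).eq_or_lt with h | h
    · rw [← h]; simp
      exact div_nonneg (div_nonneg (mul_nonneg (hr0 a) (hc0 b)) hN0) log_two_pos.le
    have h1 : 0 < r a := h.trans_le (hra a b)
    have h2 : 0 < c b := h.trans_le (hcb a b)
    have h3 : 0 < N := h1.trans_le (hrN a)
    have := ent_le_cross (hn a b) (div_pos (mul_pos h1 h2) h3).le
      fun h0 => absurd h0 (div_pos (mul_pos h1 h2) h3).ne'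
    rwa [Real.logb_div (mul_pos h1 h2).ne' h3.ne', Real.logb_mul h1.ne' h2.ne'] at this
  have hsum := sum_le_sum fun a (_ : a ∈ univ) => sum_le_sum fun b (_ : b ∈ univ) => key a b
  have e1 : ∑ a, ∑ b, (r a * c b / N - n a b) / Real.log 2 = 0 := by
    simp only [← sum_div, sum_sub_distrib, ← mul_sum, ← sum_mul, ← hNc]
    change (N * N / N - N) / Real.log 2 = 0
    by_cases h : N = 0
    · simp [h]
    · field_simp; simp
  have e2 : ∑ a, ∑ b, (ent (n a b) + n a b * (Real.logb 2 (r a) + Real.logb 2 (c b) - Real.logb 2 N))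
      = -matInfo n := by
    have s1 : ∑ a, ∑ b, n a b * Real.logb 2 (r a) = -∑ a, ent (r a) := by
      simp only [ent_eq, sum_neg_distrib, neg_neg, ← sum_mul, hr]
    have s2 : ∑ a, ∑ b, n a b * Real.logb 2 (c b) = -∑ b, ent (c b) := by
      rw [sum_comm]
      simp only [ent_eq, sum_neg_distrib, neg_neg, ← sum_mul, hc]
    have s3 : ∑ a, ∑ b, n a b * Real.logb 2 N = -ent N := by
      simp only [ent_eq, neg_neg, ← sum_mul, hN, hr]
    simp only [mul_sub, mul_add, sum_add_distrib, sum_sub_distrib, s1, s2, s3]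
    unfold matInfo
    simp only [hN, hr, hc]
    ring
  linarith

end MatInfo

/-! ### Homogeneous mutual information of a binary-input channel -/

section ChInfo

variable {𝒴 : Type} [Fintype 𝒴]

lemma DMC.prob_nonneg {𝒳 : Type} (F : DMC 𝒳 𝒴) (x : 𝒳) (y : 𝒴) : 0 ≤ F.prob x y :=
  (F.mem_stdSimplex x).1 y

lemma DMC.prob_sum {𝒳 : Type} (F : DMC 𝒳 𝒴) (x : 𝒳) : ∑ y, F.prob x y = 1 :=
  (F.mem_stdSimplex x).2

/-- The mutual information `I(X;Y)` when the input symbols `0`, `1` have (unnormalized) masses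
`a`, `b`. -/
noncomputable def chInfo (F : DMC (Fin 2) 𝒴) (a b : ℝ) : ℝ :=
  ∑ y, ent (a * F.prob 0 y + b * F.prob 1 y) - ent (a + b)
    - a * ∑ y, ent (F.prob 0 y) - b * ∑ y, ent (F.prob 1 y)

/-- The homogeneous binary entropy. -/
noncomputable def binEnt (a b : ℝ) : ℝ := ent a + ent b - ent (a + b)

lemma binEnt_comm (a b : ℝ) : binEnt a b = binEnt b a := by
  simp only [binEnt, add_comm b a]; ring

@[simp] lemma binEnt_zero_left (b : ℝ) : binEnt 0 b = 0 := by simp [binEnt]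

@[simp] lemma binEnt_zero_right (a : ℝ) : binEnt a 0 = 0 := by simp [binEnt]

lemma binEnt_mul (c a b : ℝ) : binEnt (c * a) (c * b) = c * binEnt a b := by
  simp only [binEnt, ← mul_add, ent_mul]; ring

/-- The passage from `H(Y) - H(Y|X)` to `H(X) - H(X|Y)`. The second form turns inequalities for
`chInfo` into termwise inequalities for `binEnt`, one for each output letter. -/
lemma chInfo_eq (F : DMC (Fin 2) 𝒴) (a b : ℝ) :
    chInfo F a b = binEnt a b - ∑ y, binEnt (a * F.prob 0 y) (b * F.prob 1 y) := by
  simp only [chInfo, binEnt, ent_mul a, ent_mul b, sum_sub_distrib, sum_add_distrib, ← mul_sum,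
    ← sum_mul, F.prob_sum]
  ring

lemma chInfo_mul (F : DMC (Fin 2) 𝒴) (c a b : ℝ) :
    chInfo F (c * a) (c * b) = c * chInfo F a b := by
  simp only [chInfo_eq, mul_assoc, binEnt_mul, ← mul_sum]; ring

@[simp] lemma chInfo_zero_left (F : DMC (Fin 2) 𝒴) (b : ℝ) : chInfo F 0 b = 0 := by
  simp [chInfo_eq]

@[simp] lemma chInfo_zero_right (F : DMC (Fin 2) 𝒴) (a : ℝ) : chInfo F a 0 = 0 := by
  simp [chInfo_eq]

lemma continuous_chInfo (F : DMC (Fin 2) 𝒴) : Continuous fun p : ℝ × ℝ => chInfo F p.1 p.2 := by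
  have := continuous_ent
  unfold chInfo
  fun_prop

section

variable {A B : Type} [Fintype A] [Fintype B]

/-- The chain rule `I(X;Y) - I(X;Y|Z) = I(Z;Y)` for `Z → X → Y`; nonnegativity of the right side is
the superadditivity of `chInfo`. -/
lemma chInfo_sum_sub (F : DMC (Fin 2) 𝒴) (a b : A → ℝ) :
    chInfo F (∑ z, a z) (∑ z, b z) - ∑ z, chInfo F (a z) (b z)
      = matInfo fun z y => a z * F.prob 0 y + b z * F.prob 1 y := by
  have h : ∀ z, ∑ y, (a z * F.prob 0 y + b z * F.prob 1 y) = a z + b z := fun z => by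
    simp only [sum_add_distrib, ← mul_sum, F.prob_sum, mul_one]
  simp only [matInfo, chInfo, h, sum_sub_distrib, sum_add_distrib, ← sum_mul]
  ring

lemma sum_chInfo_le (F : DMC (Fin 2) 𝒴) {a b : A → ℝ} (ha : ∀ z, 0 ≤ a z) (hb : ∀ z, 0 ≤ b z) :
    ∑ z, chInfo F (a z) (b z) ≤ chInfo F (∑ z, a z) (∑ z, b z) := by
  have := chInfo_sum_sub F a b
  have h := matInfo_nonneg (n := fun z y => a z * F.prob 0 y + b z * F.prob 1 y) fun z y =>
    add_nonneg (mul_nonneg (ha z) (F.prob_nonneg 0 y)) (mul_nonneg (hb z) (F.prob_nonneg 1 y))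
  linarith

lemma chInfo_add_le (F : DMC (Fin 2) 𝒴) {a b a' b' : ℝ} (ha : 0 ≤ a) (hb : 0 ≤ b) (ha' : 0 ≤ a')
    (hb' : 0 ≤ b') : chInfo F a b + chInfo F a' b' ≤ chInfo F (a + a') (b + b') := by
  have := sum_chInfo_le (A := Fin 2) F (a := ![a, a']) (b := ![b, b'])
    (by simp [Fin.forall_fin_two, ha, ha']) (by simp [Fin.forall_fin_two, hb, hb'])
  simpa using this

lemma chInfo_nonneg (F : DMC (Fin 2) 𝒴) {a b : ℝ} (ha : 0 ≤ a) (hb : 0 ≤ b) :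
    0 ≤ chInfo F a b := by
  simpa using chInfo_add_le F ha le_rfl le_rfl hb

/-- `I(V;Y) - I(U;V) ≤ I(X;Y|U)`. -/
lemma chInfo_sub_matInfo_le (F : DMC (Fin 2) 𝒴) {q : A → B → Fin 2 → ℝ}
    (hq : ∀ u v x, 0 ≤ q u v x) :
    chInfo F (∑ u, ∑ v, q u v 0) (∑ u, ∑ v, q u v 1)
      - ∑ v, chInfo F (∑ u, q u v 0) (∑ u, q u v 1) - matInfo (fun u v => q u v 0 + q u v 1)
      ≤ ∑ u, chInfo F (∑ v, q u v 0) (∑ v, q u v 1) := by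
  have h1 : 0 ≤ ∑ y, matInfo fun u v => q u v 0 * F.prob 0 y + q u v 1 * F.prob 1 y :=
    sum_nonneg fun y _ => matInfo_nonneg fun u v =>
      add_nonneg (mul_nonneg (hq u v 0) (F.prob_nonneg 0 y))
        (mul_nonneg (hq u v 1) (F.prob_nonneg 1 y))
  have h2 : 0 ≤ ∑ u, ∑ v, chInfo F (q u v 0) (q u v 1) :=
    sum_nonneg fun u _ => sum_nonneg fun v _ => chInfo_nonneg F (hq u v 0) (hq u v 1)
  -- The left side is `I(U;V|Y)`; the identity reads `I(U;V|Y) = I(X;Y|U) + I(X;Y|V) - I(X;Y|U,V) -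
  -- I(X;Y) + I(U;V)`.
  have e : (∑ y, matInfo fun u v => q u v 0 * F.prob 0 y + q u v 1 * F.prob 1 y)
      = ∑ u, chInfo F (∑ v, q u v 0) (∑ v, q u v 1)
        + ∑ v, chInfo F (∑ u, q u v 0) (∑ u, q u v 1)
        - ∑ u, ∑ v, chInfo F (q u v 0) (q u v 1)
        - chInfo F (∑ u, ∑ v, q u v 0) (∑ u, ∑ v, q u v 1)
        + matInfo (fun u v => q u v 0 + q u v 1) := by
    have c0 : ∑ v, ∑ u, q u v 0 = ∑ u, ∑ v, q u v 0 := sum_comm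
    have c1 : ∑ v, ∑ u, q u v 1 = ∑ u, ∑ v, q u v 1 := sum_comm
    have d1 := sum_comm (s := (univ : Finset 𝒴)) (t := (univ : Finset A))
      (f := fun y u => ent ((∑ v, q u v 0) * F.prob 0 y + (∑ v, q u v 1) * F.prob 1 y))
    have d2 := sum_comm (s := (univ : Finset 𝒴)) (t := (univ : Finset B))
      (f := fun y v => ent ((∑ u, q u v 0) * F.prob 0 y + (∑ u, q u v 1) * F.prob 1 y))
    have d3 : ∑ y, ∑ u, ∑ v, ent (q u v 0 * F.prob 0 y + q u v 1 * F.prob 1 y)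
        = ∑ u, ∑ v, ∑ y, ent (q u v 0 * F.prob 0 y + q u v 1 * F.prob 1 y) := by
      rw [sum_comm]; exact sum_congr rfl fun u _ => sum_comm
    simp only [matInfo, chInfo, sum_sub_distrib, sum_add_distrib, ← sum_mul, c0, c1, d1, d2, d3]
    ring
  linarith

end

end ChInfo

/-! ### A two-channel inequality when the input is a function of binary `U`, `V` -/

lemma sum_binEnt_le {A : Type} [Fintype A] {a b : A → ℝ} (ha : ∀ z, 0 ≤ a z)
    (hb : ∀ z, 0 ≤ b z) : ∑ z, binEnt (a z) (b z) ≤ binEnt (∑ z, a z) (∑ z, b z) := by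
  have h := matInfo_nonneg (n := fun z => ![a z, b z])
    (fun z => by simp [Fin.forall_fin_two, ha, hb])
  simp only [matInfo, Fin.sum_univ_two, Matrix.cons_val_zero, Matrix.cons_val_one,
    sum_add_distrib] at h
  simp only [binEnt, sum_sub_distrib, sum_add_distrib]
  linarith

/-- A homogeneous function is the perspective of its restriction to the simplex, so Jensen with
weights proportional to the masses `a z + b z` gives subadditivity. -/
lemma subadditive_of_convexOn {Φ : ℝ → ℝ → ℝ} (hΦ : ∀ c a b, Φ (c * a) (c * b) = c * Φ a b)
    (hconv : ConvexOn ℝ (Set.Icc 0 1) fun t => Φ t (1 - t))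
    {A : Type} [Fintype A] {a b : A → ℝ} (ha : ∀ z, 0 ≤ a z) (hb : ∀ z, 0 ≤ b z) :
    Φ (∑ z, a z) (∑ z, b z) ≤ ∑ z, Φ (a z) (b z) := by
  set M := ∑ z, (a z + b z) with hM
  have hs : ∀ z, 0 ≤ a z + b z := fun z => add_nonneg (ha z) (hb z)
  have hM0 : 0 ≤ M := sum_nonneg fun z _ => hs z
  have hΦ0 : Φ 0 0 = 0 := by simpa using hΦ 0 0 0
  rcases hM0.eq_or_lt with h | h
  · have hz : ∀ z, a z + b z = 0 := fun z =>
      (sum_eq_zero_iff_of_nonneg fun z _ => hs z).1 h.symm z (mem_univ z)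
    have ha0 : ∀ z, a z = 0 := fun z => le_antisymm (by linarith [hz z, hb z]) (ha z)
    have hb0 : ∀ z, b z = 0 := fun z => le_antisymm (by linarith [hz z, ha z]) (hb z)
    simp [ha0, hb0, hΦ0]
  have key := hconv.map_sum_le (t := univ) (w := fun z => (a z + b z) / M)
    (p := fun z => a z / (a z + b z)) (fun z _ => div_nonneg (hs z) hM0)
    (by rw [← sum_div, ← hM, div_self h.ne'])
    (fun z _ => ⟨div_nonneg (ha z) (hs z), div_le_one_of_le₀ (by linarith [hb z]) (hs z)⟩)
  have e1 : ∀ z, (a z + b z) / M * (a z / (a z + b z)) = a z / M := fun z => by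
    rcases (hs z).eq_or_lt with h' | h'
    · have : a z = 0 := le_antisymm (by linarith [hb z]) (ha z)
      simp [this]
    · field_simp
  have e2 : ∀ z, (a z + b z) * Φ (a z / (a z + b z)) (1 - a z / (a z + b z)) = Φ (a z) (b z) := by
    intro z
    rcases (hs z).eq_or_lt with h' | h'
    · have h1 : a z = 0 := le_antisymm (by linarith [hb z]) (ha z)
      have h2 : b z = 0 := by linarith
      simp [h1, h2, hΦ0]
    · rw [← hΦ]; congr 1 <;> field_simp; ring
  simp only [smul_eq_mul, e1, ← sum_div] at key
  have e3 : ∑ z, (a z + b z) / M * Φ (a z / (a z + b z)) (1 - a z / (a z + b z))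
      = (∑ z, Φ (a z) (b z)) / M := by
    rw [sum_div]
    exact sum_congr rfl fun z _ => by rw [div_mul_eq_mul_div, e2]
  rw [e3, le_div_iff₀ h, mul_comm, ← hΦ] at key
  have hMab : M = ∑ z, a z + ∑ z, b z := sum_add_distrib
  have e4 : M * (1 - (∑ z, a z) / M) = ∑ z, b z := by field_simp; linarith
  rwa [mul_div_cancel₀ _ h.ne', e4] at key

lemma ent_add_ent_one_sub (t : ℝ) : ent t + ent (1 - t) = Real.binEntropy t / Real.log 2 := by
  rw [Real.binEntropy_eq_negMulLog_add_negMulLog_one_sub, ent, ent, add_div]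

/-- With `u = β + (α - β) * t`, `p² = αβ`, `r² = (1 - α)(1 - β)`, the second derivative has the sign
of `(1 - κ)u(1 - u) - (α - β)²t(1 - t)`. Since `u(1 - u) - (α - β)²t(1 - t) = ur² + (1 - u)p²`, and
this exceeds `(p + r)²u(1 - u)` by the square of `ur - (1 - u)p`, the squared Bhattacharyya
coefficient `(p + r)²` is an admissible `κ`. The condition `α ≠ β` keeps `u` inside `(0,1)`. -/
lemma convexOn_binEntropy_comp_sub {α β κ : ℝ} (hα : α ∈ Set.Icc (0 : ℝ) 1)
    (hβ : β ∈ Set.Icc (0 : ℝ) 1) (hne : α ≠ β)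
    (hκ : κ ≤ (√(α * β) + √((1 - α) * (1 - β))) ^ 2) :
    ConvexOn ℝ (Set.Icc 0 1)
      fun t => Real.binEntropy (β + (α - β) * t) - (1 - κ) * Real.binEntropy t := by
  obtain ⟨hα0, hα1⟩ := hα
  obtain ⟨hβ0, hβ1⟩ := hβ
  have hu : ∀ t ∈ Set.Ioo (0 : ℝ) 1, 0 < β + (α - β) * t ∧ β + (α - β) * t < 1 := by
    rintro t ⟨h0, h1⟩
    rcases lt_or_gt_of_ne hne with h | h
    · constructor <;> nlinarith
    · constructor <;> nlinarith
  have hd1 : ∀ t ∈ Set.Ioo (0 : ℝ) 1, HasDerivAt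
      (fun t => Real.binEntropy (β + (α - β) * t) - (1 - κ) * Real.binEntropy t)
      ((Real.log (1 - (β + (α - β) * t)) - Real.log (β + (α - β) * t)) * (α - β)
        - (1 - κ) * (Real.log (1 - t) - Real.log t)) t := by
    intro t ht
    have hl : HasDerivAt (fun t => β + (α - β) * t) (α - β) t := by
      simpa using ((hasDerivAt_id t).const_mul (α - β)).const_add β
    exact ((Real.hasDerivAt_binEntropy (hu t ht).1.ne' (hu t ht).2.ne).comp t hl).sub
      ((Real.hasDerivAt_binEntropy ht.1.ne' ht.2.ne).const_mul (1 - κ))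
  have hd2 : ∀ t ∈ Set.Ioo (0 : ℝ) 1, HasDerivAt
      (fun t => (Real.log (1 - (β + (α - β) * t)) - Real.log (β + (α - β) * t)) * (α - β)
        - (1 - κ) * (Real.log (1 - t) - Real.log t))
      ((-(α - β) / (1 - (β + (α - β) * t)) - (α - β) / (β + (α - β) * t)) * (α - β)
        - (1 - κ) * (-1 / (1 - t) - 1 / t)) t := by
    intro t ht
    have hl : HasDerivAt (fun t => β + (α - β) * t) (α - β) t := by
      simpa using ((hasDerivAt_id t).const_mul (α - β)).const_add β
    have h1 := (hl.const_sub 1).log (sub_pos.2 (hu t ht).2).ne'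
    have h2 := hl.log (hu t ht).1.ne'
    have h3 := ((hasDerivAt_id t).const_sub 1).log (sub_pos.2 ht.2).ne'
    have h4 := (hasDerivAt_id t).log ht.1.ne'
    exact ((h1.sub h2).mul_const (α - β)).sub ((h3.sub h4).const_mul (1 - κ))
  refine convexOn_of_hasDerivWithinAt2_nonneg (convex_Icc 0 1) ?_
    (f' := fun t => (Real.log (1 - (β + (α - β) * t)) - Real.log (β + (α - β) * t)) * (α - β)
        - (1 - κ) * (Real.log (1 - t) - Real.log t))
    (f'' := fun t => (-(α - β) / (1 - (β + (α - β) * t)) - (α - β) / (β + (α - β) * t)) * (α - β)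
        - (1 - κ) * (-1 / (1 - t) - 1 / t)) ?_ ?_ ?_
  · have := Real.binEntropy_continuous
    exact Continuous.continuousOn (by fun_prop)
  · rw [interior_Icc]; exact fun t ht => (hd1 t ht).hasDerivWithinAt
  · rw [interior_Icc]; exact fun t ht => (hd2 t ht).hasDerivWithinAt
  · rw [interior_Icc]
    intro t ht
    obtain ⟨hu0, hu1⟩ := hu t ht
    set u := β + (α - β) * t with hudef
    have hv : 0 < 1 - u := sub_pos.2 hu1
    have ht1 : 0 < 1 - t := sub_pos.2 ht.2
    have ht0 : 0 < t := ht.1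
    have e : (-(α - β) / (1 - u) - (α - β) / u) * (α - β) - (1 - κ) * (-1 / (1 - t) - 1 / t)
        = ((1 - κ) * (u * (1 - u)) - (α - β) ^ 2 * (t * (1 - t))) / ((u * (1 - u)) * (t * (1 - t))) := by
      field_simp; ring
    rw [e]
    refine div_nonneg ?_ (by positivity)
    set p := √(α * β)
    set r := √((1 - α) * (1 - β))
    have hp : p ^ 2 = α * β := Real.sq_sqrt (mul_nonneg hα0 hβ0)
    have hr : r ^ 2 = (1 - α) * (1 - β) :=
      Real.sq_sqrt (mul_nonneg (sub_nonneg.2 hα1) (sub_nonneg.2 hβ1))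
    have h1 : κ * (u * (1 - u)) ≤ (p + r) ^ 2 * (u * (1 - u)) :=
      mul_le_mul_of_nonneg_right hκ (mul_pos hu0 hv).le
    have h2 : (p + r) ^ 2 * (u * (1 - u)) ≤ u * r ^ 2 + (1 - u) * p ^ 2 := by
      nlinarith [sq_nonneg (u * r - (1 - u) * p)]
    have h3 : u * (1 - u) - (α - β) ^ 2 * (t * (1 - t)) = u * r ^ 2 + (1 - u) * p ^ 2 := by
      rw [hp, hr, hudef]; ring
    linarith

/-- A strong data-processing inequality for a binary channel `X → U`. -/
lemma chInfo_sdpi {𝒴 : Type} [Fintype 𝒴] (F : DMC (Fin 2) 𝒴) {α β κ a b : ℝ}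
    (hα : α ∈ Set.Icc (0 : ℝ) 1) (hβ : β ∈ Set.Icc (0 : ℝ) 1) (hκ1 : κ ≤ 1)
    (hκ : κ ≤ (√(α * β) + √((1 - α) * (1 - β))) ^ 2) (ha : 0 ≤ a) (hb : 0 ≤ b) :
    κ * chInfo F a b ≤ chInfo F (α * a) (β * b) + chInfo F ((1 - α) * a) ((1 - β) * b) := by
  -- By `chInfo_eq` the claim is subadditivity of `Φ` over the output letters. On the simplex `Φ`
  -- is, up to an affine term, the function of `convexOn_binEntropy_comp_sub` divided by `log 2`.
  set Φ : ℝ → ℝ → ℝ := fun a b =>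
    κ * binEnt a b - binEnt (α * a) (β * b) - binEnt ((1 - α) * a) ((1 - β) * b) with hΦdef
  suffices h : Φ (∑ y, a * F.prob 0 y) (∑ y, b * F.prob 1 y)
      ≤ ∑ y, Φ (a * F.prob 0 y) (b * F.prob 1 y) by
    simp only [hΦdef, ← mul_sum, F.prob_sum, mul_one, sum_sub_distrib] at h
    simp only [chInfo_eq, mul_assoc]
    linarith
  have hA : ∀ y, 0 ≤ a * F.prob 0 y := fun y => mul_nonneg ha (F.prob_nonneg 0 y)
  have hB : ∀ y, 0 ≤ b * F.prob 1 y := fun y => mul_nonneg hb (F.prob_nonneg 1 y)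
  by_cases hne : α = β
  · have e : ∀ a b, Φ a b = -((1 - κ) * binEnt a b) := fun a b => by
      simp only [hΦdef, hne, binEnt_mul]; ring
    simp only [e, sum_neg_distrib, ← mul_sum]
    rw [mul_sum, mul_sum]
    exact neg_le_neg (mul_le_mul_of_nonneg_left (sum_binEnt_le hA hB) (by linarith))
  refine subadditive_of_convexOn (fun c a b => ?_) ?_ hA hB
  · simp only [hΦdef, mul_left_comm _ c, binEnt_mul]; ring
  · have h1 := ((convexOn_binEntropy_comp_sub hα hβ hne hκ).smul (inv_nonneg.2 log_two_pos.le))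
    have h2 : ConvexOn ℝ (Set.Icc (0 : ℝ) 1)
        fun t => (-ent α - ent (1 - α) + (ent β + ent (1 - β))) * t := by
      exact (LinearMap.mul ℝ ℝ _).convexOn (convex_Icc 0 1)
    have h3 := (h1.add h2).add_const (-ent β - ent (1 - β))
    refine h3.congr fun t _ => ?_
    have e1 : α * t + β * (1 - t) = β + (α - β) * t := by ring
    have e2 : (1 - α) * t + (1 - β) * (1 - t) = 1 - (β + (α - β) * t) := by ring
    simp only [hΦdef, binEnt, e1, e2, Pi.add_apply, smul_eq_mul, ent_mul,
      show t + (1 - t) = 1 by ring, ent_one]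
    have f1 := ent_add_ent_one_sub t
    have f2 := ent_add_ent_one_sub (β + (α - β) * t)
    have f3 : (Real.log 2)⁻¹ * (Real.binEntropy (β + (α - β) * t) - (1 - κ) * Real.binEntropy t)
      = (ent (β + (α - β) * t) + ent (1 - (β + (α - β) * t))) - (1 - κ) * (ent t + ent (1 - t)) := by
      rw [f1, f2]; ring
    rw [f3]; ring

/-- The geometric mean minus a common shift is monotone. -/
lemma geom_mean_add_le {l p r d : ℝ} (hl0 : 0 ≤ l) (hl1 : l ≤ 1) (hp : 0 < p) (hr : 0 < r)
    (hd : 0 ≤ d) : p ^ (1 - l) * r ^ l + d ≤ (p + d) ^ (1 - l) * (r + d) ^ l := by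
  have hP : 0 < p + d := by linarith
  have hR : 0 < r + d := by linarith
  -- The geometric mean is superadditive: AM-GM for the shares of `(p, r)` and of `(d, d)` in `(p +
  -- d, r + d)`, whose arithmetic means add up to one.
  have h1 := Real.geom_mean_le_arith_mean2_weighted (sub_nonneg.2 hl1) hl0
    (div_nonneg hp.le hP.le) (div_nonneg hr.le hR.le) (by ring)
  have h2 := Real.geom_mean_le_arith_mean2_weighted (sub_nonneg.2 hl1) hl0
    (div_nonneg hd hP.le) (div_nonneg hd hR.le) (by ring)
  rw [Real.div_rpow hp.le hP.le, Real.div_rpow hr.le hR.le] at h1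
  rw [Real.div_rpow hd hP.le, Real.div_rpow hd hR.le] at h2
  have hd' : d ^ (1 - l) * d ^ l = d := by
    rcases hd.eq_or_lt with rfl | hd
    · by_cases hl : l = 0
      · simp [hl]
      · simp [Real.zero_rpow hl]
    · rw [← Real.rpow_add hd]; simp
  set X := (p + d) ^ (1 - l)
  set Y := (r + d) ^ l
  have hX : 0 < X := Real.rpow_pos_of_pos hP _
  have hY : 0 < Y := Real.rpow_pos_of_pos hR _
  have e1 : p ^ (1 - l) / X * (r ^ l / Y) + d ^ (1 - l) / X * (d ^ l / Y)
      = (p ^ (1 - l) * r ^ l + d) / (X * Y) := by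
    rw [div_mul_div_comm, div_mul_div_comm, hd', add_div]
  have e2 : (1 - l) * (p / (p + d)) + l * (r / (r + d))
      + ((1 - l) * (d / (p + d)) + l * (d / (r + d))) = 1 := by
    field_simp; ring
  have := add_le_add h1 h2
  rw [e1, e2, div_le_one (mul_pos hX hY)] at this
  exact this

/-- Tangent line bound for a difference of binary entropies, at the point where the slope
vanishes. -/
lemma binEnt_sub_tangent {l a z : ℝ} (hl0 : 0 ≤ l) (hl1 : l ≤ 1) (ha : 0 < a) (hz : 0 < z)
    (h : a + z = (1 + z) ^ (1 - l) * z ^ l) {k₀ k₁ : ℝ} (hk₀ : 0 ≤ k₀) (hk₁ : 0 ≤ k₁) :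
    k₀ * ((1 - l) * binEnt 1 z - binEnt a z) ≤ (1 - l) * binEnt k₀ k₁ - binEnt (a * k₀) k₁ := by
  set ψ : ℝ → ℝ := fun w => (1 - l) * binEnt 1 w - binEnt a w with hψ
  have hcont : Continuous ψ := by
    have := continuous_ent
    simp only [hψ, binEnt]; fun_prop
  have hent : ∀ c w : ℝ, 0 < c + w → HasDerivAt (fun w => ent (c + w))
      ((-Real.log (c + w) - 1) / Real.log 2) w := fun c w hw => by
    have := ((Real.hasDerivAt_negMulLog hw.ne').comp_const_add c w).div_const (Real.log 2)
    exact this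
  have hK : ∀ c w : ℝ, 0 < c → 0 < w → HasDerivAt (fun w => binEnt c w)
      ((Real.log (c + w) - Real.log w) / Real.log 2) w := fun c w hc hw => by
    have h1 := hent 0 w (by linarith)
    simp only [zero_add] at h1
    have h2 := ((hasDerivAt_const w (ent c)).add h1).sub (hent c w (by linarith))
    refine (h2.congr_deriv ?_)
    ring
  have hder : ∀ w, 0 < w → HasDerivAt ψ
      (((1 - l) * Real.log (1 + w) + l * Real.log w - Real.log (a + w)) / Real.log 2) w := by
    intro w hw
    refine (((hK 1 w one_pos hw).const_mul (1 - l)).sub (hK a w ha hw)).congr_deriv ?_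
    ring
  have hlog : ∀ w, 0 < w → (1 - l) * Real.log (1 + w) + l * Real.log w
      = Real.log ((1 + w) ^ (1 - l) * w ^ l) := fun w hw => by
    have h1 : 0 < 1 + w := by linarith
    rw [Real.log_mul (Real.rpow_pos_of_pos h1 _).ne' (Real.rpow_pos_of_pos hw _).ne',
      Real.log_rpow h1, Real.log_rpow hw]
  -- The sign of `ψ'` is that of `(1 + w)^(1 - l) * w^l - (a + w)`, which is nondecreasing in `w` by
  -- `geom_mean_add_le` and vanishes at `z`; so `z` is a global minimum.
  have hmin : ∀ w, 0 ≤ w → ψ z ≤ ψ w := by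
    intro w hw
    rcases le_total w z with hwz | hwz
    · have : AntitoneOn ψ (Set.Icc 0 z) := by
        refine antitoneOn_of_hasDerivWithinAt_nonpos (convex_Icc 0 z) hcont.continuousOn
          (f' := fun w => ((1 - l) * Real.log (1 + w) + l * Real.log w - Real.log (a + w))
            / Real.log 2) ?_ ?_
        · rw [interior_Icc]; exact fun w hw => (hder w hw.1).hasDerivWithinAt
        · rw [interior_Icc]
          rintro w ⟨hw0, hw1⟩
          refine div_nonpos_of_nonpos_of_nonneg ?_ log_two_pos.le
          rw [hlog w hw0]
          have h1 := geom_mean_add_le hl0 hl1 (by linarith : 0 < 1 + w) hw0 (sub_nonneg.2 hw1.le)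
          rw [show 1 + w + (z - w) = 1 + z by ring, show w + (z - w) = z by ring, ← h] at h1
          have h2 : 0 < (1 + w) ^ (1 - l) * w ^ l :=
            mul_pos (Real.rpow_pos_of_pos (by linarith) _) (Real.rpow_pos_of_pos hw0 _)
          linarith [Real.log_le_log h2 (by linarith : _ ≤ a + w)]
      exact this ⟨hw, hwz⟩ ⟨hz.le, le_rfl⟩ hwz
    · have : MonotoneOn ψ (Set.Ici z) := by
        refine monotoneOn_of_hasDerivWithinAt_nonneg (convex_Ici z) hcont.continuousOn
          (f' := fun w => ((1 - l) * Real.log (1 + w) + l * Real.log w - Real.log (a + w))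
            / Real.log 2) ?_ ?_
        · rw [interior_Ici]; exact fun w hw => (hder w (hz.trans hw)).hasDerivWithinAt
        · rw [interior_Ici]
          intro w (hw1 : z < w)
          have hw0 := hz.trans hw1
          refine div_nonneg ?_ log_two_pos.le
          rw [hlog w hw0]
          have h1 := geom_mean_add_le hl0 hl1 (by linarith : 0 < 1 + z) hz (sub_nonneg.2 hw1.le)
          rw [show 1 + z + (w - z) = 1 + w by ring, show z + (w - z) = w by ring, ← h] at h1
          have h2 := Real.log_le_log (by linarith : 0 < a + w)
            (show a + w ≤ (1 + w) ^ (1 - l) * w ^ l by linarith)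
          linarith
      exact this (Set.mem_Ici.2 le_rfl) hwz hwz
  rcases hk₀.eq_or_lt with rfl | hk
  · simp
  have e : (1 - l) * binEnt k₀ k₁ - binEnt (a * k₀) k₁ = k₀ * ψ (k₁ / k₀) := by
    have h1 := binEnt_mul k₀ 1 (k₁ / k₀)
    have h2 := binEnt_mul k₀ a (k₁ / k₀)
    rw [mul_div_cancel₀ _ hk.ne'] at h1 h2
    rw [mul_one] at h1
    rw [mul_comm a k₀, h1, h2]; simp only [hψ]; ring
  rw [e]
  exact mul_le_mul_of_nonneg_left (hmin _ (div_nonneg hk₁ hk.le)) hk.le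

/-! ### The Marton sum, and inputs determined by one auxiliary variable -/

section Gap

variable {𝒴₁ 𝒴₂ : Type} [Fintype 𝒴₁] [Fintype 𝒴₂] {A B : Type} [Fintype A] [Fintype B]

/-- `I(U;Y₁) + I(V;Y₂) - I(U;V)`, where `q u v x` is the (unnormalized) joint law of `(U,V,X)`. -/
noncomputable def martonSum (F₁ : DMC (Fin 2) 𝒴₁) (F₂ : DMC (Fin 2) 𝒴₂) (q : A → B → Fin 2 → ℝ) : ℝ :=
  chInfo F₁ (∑ u, ∑ v, q u v 0) (∑ u, ∑ v, q u v 1)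
    - ∑ u, chInfo F₁ (∑ v, q u v 0) (∑ v, q u v 1)
    + (chInfo F₂ (∑ u, ∑ v, q u v 0) (∑ u, ∑ v, q u v 1)
      - ∑ v, chInfo F₂ (∑ u, q u v 0) (∑ u, q u v 1))
    - matInfo (fun u v => q u v 0 + q u v 1)

/-- `I(U;Y₁) + I(V;Y₂) - I(U;V) ≤ max (I(X;Y₁)) (I(X;Y₂))`. -/
def MartonSumBounded (F₁ : DMC (Fin 2) 𝒴₁) (F₂ : DMC (Fin 2) 𝒴₂) (q : A → B → Fin 2 → ℝ) : Prop :=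
  martonSum F₁ F₂ q ≤ max (chInfo F₁ (∑ u, ∑ v, q u v 0) (∑ u, ∑ v, q u v 1))
    (chInfo F₂ (∑ u, ∑ v, q u v 0) (∑ u, ∑ v, q u v 1))

variable {F₁ : DMC (Fin 2) 𝒴₁} {F₂ : DMC (Fin 2) 𝒴₂} {q : A → B → Fin 2 → ℝ}

lemma MartonSumBounded.of_swap (h : MartonSumBounded F₂ F₁ fun v u x => q u v x) :
    MartonSumBounded F₁ F₂ q := by
  unfold MartonSumBounded martonSum at *
  rw [matInfo_swap (fun u v => q u v 0 + q u v 1), sum_comm (f := fun v u => q u v 0),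
    sum_comm (f := fun v u => q u v 1), max_comm] at h
  linarith

/-- Here `X` is a function of `U`, so `I(X;Y₂|U) = 0` and `chInfo_sub_matInfo_le` gives `I(V;Y₂) ≤
I(U;V)`. -/
lemma martonSumBounded_of_input_eq_fst (hq : ∀ u v x, 0 ≤ q u v x)
    (h : ∀ u, (∀ v, q u v 0 = 0) ∨ ∀ v, q u v 1 = 0) : MartonSumBounded F₁ F₂ q := by
  have h1 := chInfo_sub_matInfo_le F₂ hq
  have h2 : ∀ {𝒴 : Type} [Fintype 𝒴] (F : DMC (Fin 2) 𝒴),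
      ∑ u, chInfo F (∑ v, q u v 0) (∑ v, q u v 1) = 0 := fun F =>
    sum_eq_zero fun u _ => by rcases h u with h | h <;> simp [h]
  unfold MartonSumBounded martonSum
  refine le_max_of_le_left ?_
  rw [h2] at h1 ⊢
  linarith

lemma martonSumBounded_of_input_eq_snd (hq : ∀ u v x, 0 ≤ q u v x)
    (h : ∀ v, (∀ u, q u v 0 = 0) ∨ ∀ u, q u v 1 = 0) : MartonSumBounded F₁ F₂ q :=
  .of_swap (martonSumBounded_of_input_eq_fst (fun v u x => hq u v x) h)

end Gap

/-! ### Binary auxiliary variables with XOR and AND inputs -/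

section Binary

variable {𝒴₁ 𝒴₂ : Type} [Fintype 𝒴₁] [Fintype 𝒴₂] {F₁ : DMC (Fin 2) 𝒴₁} {F₂ : DMC (Fin 2) 𝒴₂}

lemma sq_sqrt_add_sqrt_le_one {α β : ℝ} (hα : α ∈ Set.Icc (0 : ℝ) 1) (hβ : β ∈ Set.Icc (0 : ℝ) 1) :
    (√(α * β) + √((1 - α) * (1 - β))) ^ 2 ≤ 1 := by
  have h1 := sub_nonneg.2 hα.2
  have h2 := sub_nonneg.2 hβ.2
  rw [Real.sqrt_mul hα.1, Real.sqrt_mul h1]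
  have e1 := Real.sq_sqrt hα.1
  have e2 := Real.sq_sqrt hβ.1
  have e3 := Real.sq_sqrt h1
  have e4 := Real.sq_sqrt h2
  nlinarith [sq_nonneg (√α * √(1 - β) - √(1 - α) * √β)]

/-- Expanding both squares, the four products without roots add up to one and the cross terms are
nonnegative. Replacing `β` by `1 - β` is the passage from `X → U` to `X → V` when `X` is the XOR. -/
lemma one_sub_sq_sqrt_add_sqrt_le {α β : ℝ} (hα : α ∈ Set.Icc (0 : ℝ) 1)
    (hβ : β ∈ Set.Icc (0 : ℝ) 1) :
    1 - (√(α * β) + √((1 - α) * (1 - β))) ^ 2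
      ≤ (√(α * (1 - β)) + √((1 - α) * (1 - (1 - β)))) ^ 2 := by
  have h1 := sub_nonneg.2 hα.2
  have h2 := sub_nonneg.2 hβ.2
  rw [sub_sub_cancel]
  have e1 := Real.sq_sqrt (mul_nonneg hα.1 hβ.1)
  have e2 := Real.sq_sqrt (mul_nonneg h1 h2)
  have e3 := Real.sq_sqrt (mul_nonneg hα.1 h2)
  have e4 := Real.sq_sqrt (mul_nonneg h1 hβ.1)
  have p1 := mul_nonneg (Real.sqrt_nonneg (α * β)) (Real.sqrt_nonneg ((1 - α) * (1 - β)))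
  have p2 := mul_nonneg (Real.sqrt_nonneg (α * (1 - β))) (Real.sqrt_nonneg ((1 - α) * β))
  nlinarith

/-- With `X = U xor V`, the channels `X → U` and `X → V` have rows `(α, β)` and `(α, 1 - β)` of
probabilities of the letter `0`. Strong data processing gives `I(U;Y₁) ≤ (1 - κ) I(X;Y₁)` and
`I(V;Y₂) ≤ κ I(X;Y₂)`; the sum is at most the maximum even without subtracting `I(U;V)`. -/
lemma martonSumBounded_xor {q : Fin 2 → Fin 2 → Fin 2 → ℝ} (hq : ∀ u v x, 0 ≤ q u v x)
    (h00 : q 0 0 1 = 0) (h01 : q 0 1 0 = 0) (h10 : q 1 0 0 = 0) (h11 : q 1 1 1 = 0) :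
    MartonSumBounded F₁ F₂ q := by
  have hmi := matInfo_nonneg (n := fun u v => q u v 0 + q u v 1)
    fun u v => add_nonneg (hq u v 0) (hq u v 1)
  have n1 := hq 0 0 0
  have n2 := hq 0 1 1
  have n3 := hq 1 0 1
  have n4 := hq 1 1 0
  simp only [MartonSumBounded, martonSum, Fin.sum_univ_two, h00, h01, h10, h11, add_zero, zero_add]
  set m := matInfo fun u v => q u v 0 + q u v 1
  generalize q 0 0 0 = a at *
  generalize q 0 1 1 = b at *
  generalize q 1 0 1 = c at *
  generalize q 1 1 0 = d at *
  rcases (add_nonneg n1 n4).eq_or_lt with h | hm0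
  · have e1 : a = 0 := by linarith
    have e2 : d = 0 := by linarith
    simp [e1, e2, hmi]
  rcases (add_nonneg n2 n3).eq_or_lt with h | hm1
  · have e1 : b = 0 := by linarith
    have e2 : c = 0 := by linarith
    simp [e1, e2, hmi]
  have hα : a / (a + d) ∈ Set.Icc (0 : ℝ) 1 :=
    ⟨by positivity, div_le_one_of_le₀ (by linarith) hm0.le⟩
  have hβ : b / (b + c) ∈ Set.Icc (0 : ℝ) 1 :=
    ⟨by positivity, div_le_one_of_le₀ (by linarith) hm1.le⟩
  have hβ' : 1 - b / (b + c) ∈ Set.Icc (0 : ℝ) 1 :=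
    ⟨sub_nonneg.2 hβ.2, by linarith [hβ.1]⟩
  set κ := (√(a / (a + d) * (b / (b + c))) + √((1 - a / (a + d)) * (1 - b / (b + c)))) ^ 2 with hκ
  have hκ0 : 0 ≤ κ := sq_nonneg _
  have hκ1 : κ ≤ 1 := sq_sqrt_add_sqrt_le_one hα hβ
  have s1 := chInfo_sdpi F₁ hα hβ hκ1 le_rfl hm0.le hm1.le
  have s2 := chInfo_sdpi F₂ hα hβ' (by linarith : 1 - κ ≤ 1)
    (one_sub_sq_sqrt_add_sqrt_le hα hβ) hm0.le hm1.le
  have e1 : a / (a + d) * (a + d) = a := by field_simp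
  have e2 : (1 - a / (a + d)) * (a + d) = d := by field_simp; ring
  have e3 : b / (b + c) * (b + c) = b := by field_simp
  have e4 : (1 - b / (b + c)) * (b + c) = c := by field_simp; ring
  rw [sub_sub_cancel] at s2
  rw [e1, e2, e3, e4] at s1 s2
  have hmax1 := mul_le_mul_of_nonneg_left
    (le_max_left (chInfo F₁ (a + d) (b + c)) (chInfo F₂ (a + d) (b + c))) (sub_nonneg.2 hκ1)
  have hmax2 := mul_le_mul_of_nonneg_left
    (le_max_right (chInfo F₁ (a + d) (b + c)) (chInfo F₂ (a + d) (b + c))) hκ0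
  linarith

/-- The tangent bound is applied at each output letter and summed. The slope in the second mass
vanishes, so only the total mass `x` of input `0` remains on the lower side. -/
lemma chInfo_le_of_tangent {𝒴 : Type} [Fintype 𝒴] (F : DMC (Fin 2) 𝒴) {κ a c x y : ℝ}
    (h : ∀ k₀ k₁ : ℝ, 0 ≤ k₀ → 0 ≤ k₁ → k₀ * c ≤ κ * binEnt k₀ k₁ - binEnt (a * k₀) k₁)
    (hx : 0 ≤ x) (hy : 0 ≤ y) :
    κ * chInfo F x y - chInfo F (a * x) y ≤ κ * binEnt x y - binEnt (a * x) y - x * c := by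
  have h1 := sum_le_sum fun w (_ : w ∈ (univ : Finset 𝒴)) =>
    h _ _ (mul_nonneg hx (F.prob_nonneg 0 w)) (mul_nonneg hy (F.prob_nonneg 1 w))
  simp only [← sum_mul, ← mul_sum, F.prob_sum, mul_one, sum_sub_distrib] at h1
  simp only [chInfo_eq, mul_assoc]
  linarith

/-- With `X = U and V`, only the letter `1` of `U` or `V` leaves `X` uncertain, so `I(X;Y₁|U)` and
`I(X;Y₂|V)` are single `chInfo` terms. The aim is a weight `l` with `(1 - l) I(X;Y₁) - I(X;Y₁|U) + l
I(X;Y₂) - I(X;Y₂|V) ≤ I(U;V)`; adding `l I(X;Y₁) + (1 - l) I(X;Y₂)`, which is at most the maximum,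
finishes. -/
lemma martonSumBounded_and_of_pos {q : Fin 2 → Fin 2 → Fin 2 → ℝ}
    (h00 : q 0 0 1 = 0) (h01 : q 0 1 1 = 0) (h10 : q 1 0 1 = 0) (h11 : q 1 1 0 = 0)
    (p00 : 0 < q 0 0 0) (p01 : 0 < q 0 1 0) (p10 : 0 < q 1 0 0) (p11 : 0 ≤ q 1 1 1) :
    MartonSumBounded F₁ F₂ q := by
  simp only [MartonSumBounded, martonSum, matInfo, Fin.sum_univ_two, h00, h01, h10, h11, add_zero,
    zero_add, chInfo_zero_right]
  generalize q 0 0 0 = n at *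
  generalize q 0 1 0 = n₁ at *
  generalize q 1 0 0 = n₂ at *
  generalize q 1 1 1 = y at *
  obtain ⟨s, hs⟩ : ∃ s, s = n + n₁ + n₂ := ⟨_, rfl⟩
  have hs0 : 0 < s := by linarith
  obtain ⟨a, ha⟩ : ∃ a, a = n₂ / s := ⟨_, rfl⟩
  obtain ⟨b, hb⟩ : ∃ b, b = n₁ / s := ⟨_, rfl⟩
  have ha0 : 0 < a := ha ▸ div_pos p10 hs0
  have hb0 : 0 < b := hb ▸ div_pos p01 hs0
  have ea : n₂ = a * s := by rw [ha]; field_simp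
  have eb : n₁ = b * s := by rw [hb]; field_simp
  have en : n = (1 - a - b) * s := by rw [sub_mul, sub_mul, ← ea, ← eb]; linarith
  have hc0 : 0 < 1 - a - b := pos_of_mul_pos_left (en ▸ p00) hs0.le
  -- The value of the `(1,1)` entry that would make `U` and `V` independent. It gives `(a + z)(b +
  -- z) = (1 + z)z`, so one `l` makes the tangent conditions of both channels hold at the same `z`.
  obtain ⟨z, hz⟩ : ∃ z, z = a * b / (1 - a - b) := ⟨_, rfl⟩
  have hz0 : 0 < z := hz ▸ by positivity
  have hzab : z * (1 - a - b) = a * b := by rw [hz]; field_simp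
  have hprod : (a + z) * (b + z) = (1 + z) * z := by linarith
  have hz1 : 0 < 1 + z := by linarith
  have haz : 0 < a + z := by linarith
  have hbz : 0 < b + z := by linarith
  have hlogpos : 0 < Real.log (1 + z) - Real.log z := sub_pos.2 (Real.log_lt_log hz0 (by linarith))
  have hlogprod : Real.log (a + z) + Real.log (b + z) = Real.log (1 + z) + Real.log z := by
    rw [← Real.log_mul haz.ne' hbz.ne', hprod, Real.log_mul hz1.ne' hz0.ne']
  obtain ⟨l, hl⟩ : ∃ l, l = (Real.log (1 + z) - Real.log (a + z)) / (Real.log (1 + z) - Real.log z) :=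
    ⟨_, rfl⟩
  have hlmul : l * (Real.log (1 + z) - Real.log z) = Real.log (1 + z) - Real.log (a + z) := by
    rw [hl]; field_simp
  have hl0 : 0 ≤ l := hl ▸ div_nonneg (sub_nonneg.2 (Real.log_le_log haz (by linarith))) hlogpos.le
  have hl1 : l ≤ 1 := by
    rw [hl]
    exact div_le_one_of_le₀ (by linarith [Real.log_le_log hz0 (by linarith : z ≤ a + z)]) hlogpos.le
  have tan1 : a + z = (1 + z) ^ (1 - l) * z ^ l := by
    refine Real.log_injOn_pos haz (mul_pos (Real.rpow_pos_of_pos hz1 _)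
      (Real.rpow_pos_of_pos hz0 _)) ?_
    rw [Real.log_mul (Real.rpow_pos_of_pos hz1 _).ne' (Real.rpow_pos_of_pos hz0 _).ne',
      Real.log_rpow hz1, Real.log_rpow hz0]
    linarith
  have tan2 : b + z = (1 + z) ^ (1 - (1 - l)) * z ^ (1 - l) := by
    refine Real.log_injOn_pos hbz (mul_pos (Real.rpow_pos_of_pos hz1 _)
      (Real.rpow_pos_of_pos hz0 _)) ?_
    rw [Real.log_mul (Real.rpow_pos_of_pos hz1 _).ne' (Real.rpow_pos_of_pos hz0 _).ne',
      Real.log_rpow hz1, Real.log_rpow hz0]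
    linarith
  have b1 := chInfo_le_of_tangent F₁
    (fun k₀ k₁ => binEnt_sub_tangent hl0 hl1 ha0 hz0 tan1 (k₀ := k₀) (k₁ := k₁)) hs0.le p11
  have b2 := chInfo_le_of_tangent F₂
    (fun k₀ k₁ => binEnt_sub_tangent (sub_nonneg.2 hl1) (by linarith) hb0 hz0 tan2
      (k₀ := k₀) (k₁ := k₁)) hs0.le p11
  -- The sum of the two tangent bounds is `I(U;V)` minus `s` times the information of this table, so
  -- its nonnegativity is what is needed.
  have hmi := matInfo_nonneg (n := ![![1 - a - b, b], ![a, z]])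
    (by simp [Fin.forall_fin_two, hc0.le, hb0.le, ha0.le, hz0.le])
  simp only [matInfo, Fin.sum_univ_two, Matrix.cons_val_zero, Matrix.cons_val_one] at hmi
  have hmi' := mul_nonneg hs0.le hmi
  have e0 : (1 - a - b) * s + b * s = (1 - a) * s := by ring
  have e1 : (1 - a - b) * s + a * s = (1 - b) * s := by ring
  have e2 : 1 - a - b + a = 1 - b := by ring
  have e6 : 1 - a - b + b = 1 - a := by ring
  have e3 : (1 - a) * s + (a * s + y) = s + y := by ring
  have e4 : (1 - a) + (a + z) = 1 + z := by ring
  have e5 : (1 - a) * s + a * s = s := by ring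
  have hmax1 := mul_le_mul_of_nonneg_left
    (le_max_left (chInfo F₁ s y) (chInfo F₂ s y)) hl0
  have hmax2 := mul_le_mul_of_nonneg_left
    (le_max_right (chInfo F₁ s y) (chInfo F₂ s y)) (sub_nonneg.2 hl1)
  rw [ea, eb, en, e0, e1, e5]
  rw [e3]
  rw [e6, e2, e4] at hmi'
  simp only [binEnt, ent_one] at b1 b2
  have f1 := ent_mul (1 - a) s
  have f2 := ent_mul (1 - b) s
  have f3 := ent_mul (1 - a - b) s
  have f4 := ent_mul a s
  have f5 := ent_mul b s
  linarith

end Binary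

/-! ### Truth tables, and reduction of the alphabets to two letters -/

section Reduction

variable {𝒴₁ 𝒴₂ : Type} [Fintype 𝒴₁] [Fintype 𝒴₂] {F₁ : DMC (Fin 2) 𝒴₁} {F₂ : DMC (Fin 2) 𝒴₂}

lemma martonSumBounded_reindex_fst {A A' B : Type} [Fintype A] [Fintype A'] [Fintype B]
    {q : A → B → Fin 2 → ℝ} (e : A' ≃ A) :
    MartonSumBounded F₁ F₂ (fun u => q (e u)) ↔ MartonSumBounded F₁ F₂ q := by
  have h1 : ∀ v x, ∑ u, q (e u) v x = ∑ u, q u v x := fun v x => e.sum_comp fun u => q u v x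
  have h2 : ∀ v, ∑ u, (q (e u) v 0 + q (e u) v 1) = ∑ u, (q u v 0 + q u v 1) := fun v =>
    e.sum_comp fun u => q u v 0 + q u v 1
  unfold MartonSumBounded martonSum matInfo
  rw [e.sum_comp fun u => ∑ v, q u v 0, e.sum_comp fun u => ∑ v, q u v 1,
    e.sum_comp fun u => chInfo F₁ (∑ v, q u v 0) (∑ v, q u v 1),
    e.sum_comp fun u => ent (∑ v, (q u v 0 + q u v 1)),
    e.sum_comp fun u => ∑ v, ent (q u v 0 + q u v 1),
    e.sum_comp fun u => ∑ v, (q u v 0 + q u v 1)]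
  simp only [h1, h2]

/-- Lets the truth table of `X` be complemented. In the case analysis, symmetry of the channels
enters only here. -/
lemma martonSumBounded_flip {A B : Type} [Fintype A] [Fintype B]
    {q : A → B → Fin 2 → ℝ} (s₁ : ∀ a b, chInfo F₁ a b = chInfo F₁ b a)
    (s₂ : ∀ a b, chInfo F₂ a b = chInfo F₂ b a) :
    MartonSumBounded F₁ F₂ (fun u v x => q u v x.rev) ↔ MartonSumBounded F₁ F₂ q := by
  have h0 : (Fin.rev 0 : Fin 2) = 1 := rfl
  have h1 : (Fin.rev 1 : Fin 2) = 0 := rfl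
  unfold MartonSumBounded martonSum
  simp only [h0, h1, s₁ (∑ u, ∑ v, q u v 1), s₂ (∑ u, ∑ v, q u v 1), s₁ (∑ v, q _ v 1),
    s₂ (∑ u, q u _ 1), add_comm (q _ _ 1)]

lemma martonSumBounded_removeRow {B : Type} [Fintype B] {k : ℕ} {q : Fin (k + 1) → B → Fin 2 → ℝ}
    (i : Fin (k + 1)) (h : ∀ v x, q i v x = 0) :
    MartonSumBounded F₁ F₂ (fun u => q (i.succAbove u)) ↔ MartonSumBounded F₁ F₂ q := by
  unfold MartonSumBounded martonSum matInfo
  simp only [Fin.sum_univ_succAbove _ i, h, sum_const_zero, zero_add, add_zero, ent_zero,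
    chInfo_zero_left]

lemma martonSumBounded_and {q : Fin 2 → Fin 2 → Fin 2 → ℝ} (hq : ∀ u v x, 0 ≤ q u v x)
    (h00 : q 0 0 1 = 0) (h01 : q 0 1 1 = 0) (h10 : q 1 0 1 = 0) (h11 : q 1 1 0 = 0) :
    MartonSumBounded F₁ F₂ q := by
  rcases (hq 1 0 0).eq_or_lt with h | p10
  · refine martonSumBounded_of_input_eq_fst hq ?_
    simp [Fin.forall_fin_two, h00, h01, h11, ← h]
  rcases (hq 0 1 0).eq_or_lt with h | p01
  · refine martonSumBounded_of_input_eq_snd hq ?_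
    simp [Fin.forall_fin_two, h00, h10, h11, ← h]
  -- Without the cell `(0,0)` the AND table is also a XOR table after exchanging the letters of `U`.
  rcases (hq 0 0 0).eq_or_lt with h | p00
  · rw [← martonSumBounded_reindex_fst Fin.revPerm]
    exact martonSumBounded_xor (fun u v x => hq _ v x) h10 h11 h.symm h01
  exact martonSumBounded_and_of_pos h00 h01 h10 h11 p00 p01 p10 (hq 1 1 1)

lemma martonSumBounded_and' {q : Fin 2 → Fin 2 → Fin 2 → ℝ} (hq : ∀ u v x, 0 ≤ q u v x)
    (u v : Fin 2) (h : ∀ u' v', q u' v' (if u' = u ∧ v' = v then 0 else 1) = 0) :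
    MartonSumBounded F₁ F₂ q := by
  have key : ∀ (q : Fin 2 → Fin 2 → Fin 2 → ℝ) (v : Fin 2), (∀ u v x, 0 ≤ q u v x) →
      (∀ u' v', q u' v' (if u' = 1 ∧ v' = v then 0 else 1) = 0) → MartonSumBounded F₁ F₂ q := by
    intro q v hq h
    fin_cases v
    · refine .of_swap ?_
      rw [← martonSumBounded_reindex_fst Fin.revPerm]
      refine .of_swap (martonSumBounded_and (fun u v x => hq _ _ _) ?_ ?_ ?_ ?_)
      exacts [h 0 1, h 0 0, h 1 1, h 1 0]
    · exact martonSumBounded_and hq (h 0 0) (h 0 1) (h 1 0) (h 1 1)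
  fin_cases u
  · rw [← martonSumBounded_reindex_fst Fin.revPerm]
    refine key _ v (fun u v x => hq _ _ _) ?_
    intro u' v'
    have := h u'.rev v'
    fin_cases u' <;> simpa using this
  · exact key q v hq h

/-- The inequality for binary `U`, `V` and an input that is a function of `(U,V)`. -/
lemma martonSumBounded_of_deterministic {q : Fin 2 → Fin 2 → Fin 2 → ℝ}
    (s₁ : ∀ a b, chInfo F₁ a b = chInfo F₁ b a) (s₂ : ∀ a b, chInfo F₂ a b = chInfo F₂ b a)
    (hq : ∀ u v x, 0 ≤ q u v x) (hd : ∀ u v, q u v 0 = 0 ∨ q u v 1 = 0) :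
    MartonSumBounded F₁ F₂ q := by
  have hflip := martonSumBounded_flip (q := q) s₁ s₂
  have hq' : ∀ u v (x : Fin 2), 0 ≤ q u v x.rev := fun u v x => hq _ _ _
  -- Sixteen truth tables: six depend on at most one variable, two are XOR and its complement, and
  -- eight have a single exceptional cell (AND type).
  rcases hd 0 0 with h00 | h00 <;> rcases hd 0 1 with h01 | h01 <;>
  rcases hd 1 0 with h10 | h10 <;> rcases hd 1 1 with h11 | h11 <;>
  first
  | (refine martonSumBounded_of_input_eq_fst hq ?_; simp [Fin.forall_fin_two, h00, h01, h10, h11]; done)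
  | (refine martonSumBounded_of_input_eq_snd hq ?_; simp [Fin.forall_fin_two, h00, h01, h10, h11]; done)
  | exact martonSumBounded_xor hq h00 h01 h10 h11
  | exact hflip.1 (martonSumBounded_xor hq' h00 h01 h10 h11)
  | (refine martonSumBounded_and' hq 0 0 ?_; simp [Fin.forall_fin_two, h00, h01, h10, h11]; done)
  | (refine martonSumBounded_and' hq 0 1 ?_; simp [Fin.forall_fin_two, h00, h01, h10, h11]; done)
  | (refine martonSumBounded_and' hq 1 0 ?_; simp [Fin.forall_fin_two, h00, h01, h10, h11]; done)
  | (refine martonSumBounded_and' hq 1 1 ?_; simp [Fin.forall_fin_two, h00, h01, h10, h11]; done)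
  | (refine hflip.1 (martonSumBounded_and' hq' 0 0 ?_); simp [Fin.forall_fin_two, h00, h01, h10, h11]; done)
  | (refine hflip.1 (martonSumBounded_and' hq' 0 1 ?_); simp [Fin.forall_fin_two, h00, h01, h10, h11]; done)
  | (refine hflip.1 (martonSumBounded_and' hq' 1 0 ?_); simp [Fin.forall_fin_two, h00, h01, h10, h11]; done)
  | (refine hflip.1 (martonSumBounded_and' hq' 1 1 ?_); simp [Fin.forall_fin_two, h00, h01, h10, h11])

section Weights

variable {A B : Type} [Fintype A] [Fintype B]

/-- Exhibits the dependence on the weights: terms that see only the law of `X`, a term linear in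
`w`, and minus a sum of `ent` at linear forms in `w`. With the law of `X` fixed, the Marton sum is
therefore convex in `w`. -/
lemma martonSum_weighted (q : A → B → Fin 2 → ℝ) (w : A → ℝ) :
    martonSum F₁ F₂ (fun u v x => w u * q u v x) =
      chInfo F₁ (∑ u, ∑ v, w u * q u v 0) (∑ u, ∑ v, w u * q u v 1)
      + chInfo F₂ (∑ u, ∑ v, w u * q u v 0) (∑ u, ∑ v, w u * q u v 1)
      + ent (∑ u, ∑ v, w u * q u v 0 + ∑ u, ∑ v, w u * q u v 1)
      + (∑ u, ∑ v, w u * q u v 0) * ∑ y, ent (F₂.prob 0 y)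
      + (∑ u, ∑ v, w u * q u v 1) * ∑ y, ent (F₂.prob 1 y)
      + ∑ u, w u * (∑ v, ent (q u v 0 + q u v 1) - ent (∑ v, (q u v 0 + q u v 1))
        - chInfo F₁ (∑ v, q u v 0) (∑ v, q u v 1))
      - ∑ v, ∑ y, ent (∑ u, w u * (q u v 0 * F₂.prob 0 y + q u v 1 * F₂.prob 1 y)) := by
  have h1 : ∀ v, chInfo F₂ (∑ u, w u * q u v 0) (∑ u, w u * q u v 1)
      = ∑ y, ent (∑ u, w u * (q u v 0 * F₂.prob 0 y + q u v 1 * F₂.prob 1 y))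
        - ent (∑ u, w u * (q u v 0 + q u v 1))
        - (∑ u, w u * q u v 0) * ∑ y, ent (F₂.prob 0 y)
        - (∑ u, w u * q u v 1) * ∑ y, ent (F₂.prob 1 y) := fun v => by
    simp only [chInfo, sum_mul, ← sum_add_distrib, mul_add, mul_assoc]
  have h2 : ∀ u, ∑ v, ent (w u * (q u v 0 + q u v 1)) =
      (∑ v, (q u v 0 + q u v 1)) * ent (w u) + w u * ∑ v, ent (q u v 0 + q u v 1) := fun u => by
    simp only [ent_mul, sum_add_distrib, ← sum_mul, ← mul_sum]
  have h3 : ∑ v, ∑ u, w u * q u v 0 = ∑ u, ∑ v, w u * q u v 0 := sum_comm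
  have h4 : ∑ v, ∑ u, w u * q u v 1 = ∑ u, ∑ v, w u * q u v 1 := sum_comm
  have h5 : ∀ u, ent (w u * ∑ v, q u v 0 + w u * ∑ v, q u v 1)
      = (∑ v, q u v 0) * ent (w u) + (∑ v, q u v 1) * ent (w u)
        + w u * ent (∑ v, q u v 0 + ∑ v, q u v 1) := fun u => by
    rw [← mul_add, ent_mul]; ring
  unfold martonSum matInfo
  simp only [h1, ← mul_add, ← mul_sum, chInfo_mul, sum_sub_distrib, h2, ← sum_mul]
  simp only [mul_sum, h3, h4]
  simp only [← mul_sum, mul_sub, sum_sub_distrib, mul_add, add_mul, sum_add_distrib, h5]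
  ring

lemma martonSum_le_of_convex_combination {q : A → B → Fin 2 → ℝ} (hq : ∀ u v x, 0 ≤ q u v x)
    {w w' : A → ℝ} (hw : ∀ u, 0 ≤ w u) (hw' : ∀ u, 0 ≤ w' u) {t t' : ℝ} (ht : 0 ≤ t) (ht' : 0 ≤ t')
    (htt : t + t' = 1) (hone : ∀ u, t * w u + t' * w' u = 1)
    (hm : ∀ x, ∑ u, ∑ v, w u * q u v x = ∑ u, ∑ v, q u v x)
    (hm' : ∀ x, ∑ u, ∑ v, w' u * q u v x = ∑ u, ∑ v, q u v x) :
    martonSum F₁ F₂ q ≤ t * martonSum F₁ F₂ (fun u v x => w u * q u v x)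
      + t' * martonSum F₁ F₂ (fun u v x => w' u * q u v x) := by
  have h0 := martonSum_weighted (F₁ := F₁) (F₂ := F₂) q (fun _ => 1)
  have h1 := martonSum_weighted (F₁ := F₁) (F₂ := F₂) q w
  have h2 := martonSum_weighted (F₁ := F₁) (F₂ := F₂) q w'
  simp only [hm, hm'] at h1 h2
  simp only [one_mul] at h0
  rw [h0, h1, h2]
  set g : A → ℝ := fun u => ∑ v, ent (q u v 0 + q u v 1) - ent (∑ v, (q u v 0 + q u v 1))
        - chInfo F₁ (∑ v, q u v 0) (∑ v, q u v 1)
  have hg : ∑ u, g u = t * ∑ u, w u * g u + t' * ∑ u, w' u * g u := by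
    rw [mul_sum, mul_sum, ← sum_add_distrib]
    exact sum_congr rfl fun u _ => by linear_combination -(g u) * hone u
  have hpos : ∀ u v y, 0 ≤ q u v 0 * F₂.prob 0 y + q u v 1 * F₂.prob 1 y := fun u v y =>
    add_nonneg (mul_nonneg (hq u v 0) (F₂.prob_nonneg 0 y))
      (mul_nonneg (hq u v 1) (F₂.prob_nonneg 1 y))
  have he : t * ∑ v, ∑ y, ent (∑ u, w u * (q u v 0 * F₂.prob 0 y + q u v 1 * F₂.prob 1 y))
      + t' * ∑ v, ∑ y, ent (∑ u, w' u * (q u v 0 * F₂.prob 0 y + q u v 1 * F₂.prob 1 y))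
      ≤ ∑ v, ∑ y, ent (∑ u, (q u v 0 * F₂.prob 0 y + q u v 1 * F₂.prob 1 y)) := by
    simp only [mul_sum _ _ t, mul_sum _ _ t', ← sum_add_distrib]
    refine sum_le_sum fun v _ => sum_le_sum fun y _ => ?_
    have := concaveOn_ent.2 (x := ∑ u, w u * (q u v 0 * F₂.prob 0 y + q u v 1 * F₂.prob 1 y))
      (sum_nonneg fun u _ => mul_nonneg (hw u) (hpos u v y))
      (y := ∑ u, w' u * (q u v 0 * F₂.prob 0 y + q u v 1 * F₂.prob 1 y))
      (sum_nonneg fun u _ => mul_nonneg (hw' u) (hpos u v y)) ht ht' htt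
    simp only [smul_eq_mul] at this
    refine this.trans_eq (congrArg ent ?_)
    rw [mul_sum, mul_sum, ← sum_add_distrib]
    exact sum_congr rfl fun u _ => by
      linear_combination (q u v 0 * F₂.prob 0 y + q u v 1 * F₂.prob 1 y) * hone u
  rw [hg]
  obtain rfl : t' = 1 - t := by linarith
  linarith

end Weights

/-- A direction for reweighting the letters of `U` that leaves the law of the binary `X` unchanged:
two constraints against more than two unknowns. -/
lemma exists_linear_relation {k : ℕ} (hk : 2 < k) (m : Fin k → Fin 2 → ℝ) :
    ∃ L : Fin k → ℝ, L ≠ 0 ∧ ∀ x, ∑ u, L u * m u x = 0 := by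
  have h := LinearMap.ker_ne_bot_of_finrank_lt (f := Fintype.linearCombination ℝ m) (by simpa using hk)
  obtain ⟨L, hL, hL0⟩ := Submodule.exists_mem_ne_zero_of_ne_bot h
  refine ⟨L, hL0, fun x => ?_⟩
  have := congrFun (LinearMap.mem_ker.1 hL) x
  simpa [Fintype.linearCombination_apply] using this

/-- Reduction of the alphabet of `U` to two letters. -/
lemma martonSumBounded_reduce_fst {B : Type} [Fintype B] (R : (B → Fin 2 → ℝ) → Prop)
    (hR : ∀ ν c, R ν → R fun v x => c * ν v x)
    (base : ∀ q : Fin 2 → B → Fin 2 → ℝ, (∀ u v x, 0 ≤ q u v x) → (∀ u, R (q u)) →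
      MartonSumBounded F₁ F₂ q) (hR0 : R fun _ _ => 0) :
    ∀ (k : ℕ) (q : Fin k → B → Fin 2 → ℝ), (∀ u v x, 0 ≤ q u v x) → (∀ u, R (q u)) →
      MartonSumBounded F₁ F₂ q := by
  -- Alphabets with fewer than two letters are filled up with zero rows.
  have pad : ∀ k, (∀ q : Fin (k + 1) → B → Fin 2 → ℝ, (∀ u v x, 0 ≤ q u v x) → (∀ u, R (q u)) →
      MartonSumBounded F₁ F₂ q) → ∀ q : Fin k → B → Fin 2 → ℝ, (∀ u v x, 0 ≤ q u v x) →
      (∀ u, R (q u)) → MartonSumBounded F₁ F₂ q := by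
    intro k H q hq hqR
    have := (martonSumBounded_removeRow (F₁ := F₁) (F₂ := F₂)
      (q := (Fin.cons (fun _ _ => 0) q : Fin (k + 1) → B → Fin 2 → ℝ)) 0 (by simp)).2
      (H _ (by simpa [Fin.forall_fin_succ] using hq) (by simpa [Fin.forall_fin_succ, hR0] using hqR))
    simpa using this
  have step : ∀ k, 2 ≤ k → (∀ q : Fin k → B → Fin 2 → ℝ, (∀ u v x, 0 ≤ q u v x) → (∀ u, R (q u)) →
      MartonSumBounded F₁ F₂ q) → ∀ q : Fin (k + 1) → B → Fin 2 → ℝ, (∀ u v x, 0 ≤ q u v x) →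
      (∀ u, R (q u)) → MartonSumBounded F₁ F₂ q := by
    intro k hk H q hq hqR
    by_cases hrow : ∃ i, ∀ v x, q i v x = 0
    · obtain ⟨i, hi⟩ := hrow
      exact (martonSumBounded_removeRow i hi).1 (H _ (fun u v x => hq _ _ _) fun u => hqR _)
    push Not at hrow
    obtain ⟨L, hL0, hL⟩ := exists_linear_relation (by omega : 2 < k + 1)
      fun u x => ∑ v, q u v x
    have hpos : ∀ u, 0 < ∑ v, (q u v 0 + q u v 1) := by
      intro u
      obtain ⟨v, x, hvx⟩ := hrow u
      have hle : ∀ v, 0 ≤ q u v 0 + q u v 1 := fun v => add_nonneg (hq u v 0) (hq u v 1)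
      refine sum_pos' (fun v _ => hle v) ⟨v, mem_univ v, ?_⟩
      have hlt := lt_of_le_of_ne (hq u v x) hvx.symm
      fin_cases x
      · exact add_pos_of_pos_of_nonneg hlt (hq u v 1)
      · exact add_pos_of_nonneg_of_pos (hq u v 0) hlt
    have hsum : ∑ u, L u * ∑ v, (q u v 0 + q u v 1) = 0 := by
      simp only [sum_add_distrib, mul_add]
      rw [hL 0, hL 1, add_zero]
    -- All rows have positive mass, so `L` takes both signs. Moving along `-L` and along `L` until a
    -- weight vanishes removes the letter `u₁`, respectively `u₂`; the law is a mixture of these two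
    -- endpoints, and convexity concludes.
    obtain ⟨u₁, -, hu₁⟩ := exists_max_image univ L ⟨0, mem_univ _⟩
    obtain ⟨u₂, -, hu₂⟩ := exists_min_image univ L ⟨0, mem_univ _⟩
    have hmax : 0 < L u₁ := by
      by_contra hcon
      refine hL0 (funext fun u => ?_)
      have hall : ∀ u ∈ univ, L u * ∑ v, (q u v 0 + q u v 1) ≤ 0 := fun u hu =>
        mul_nonpos_of_nonpos_of_nonneg ((hu₁ u hu).trans (not_lt.1 hcon)) (hpos u).le
      have := (sum_eq_zero_iff_of_nonpos hall).1 hsum u (mem_univ u)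
      simpa [(hpos u).ne'] using this
    have hmin : L u₂ < 0 := by
      by_contra hcon
      refine hL0 (funext fun u => ?_)
      have hall : ∀ u ∈ univ, 0 ≤ L u * ∑ v, (q u v 0 + q u v 1) := fun u hu =>
        mul_nonneg ((not_lt.1 hcon).trans (hu₂ u hu)) (hpos u).le
      have := (sum_eq_zero_iff_of_nonneg hall).1 hsum u (mem_univ u)
      simpa [(hpos u).ne'] using this
    have mass : ∀ (c : ℝ) (x : Fin 2),
        ∑ u, ∑ v, (1 - L u / c) * q u v x = ∑ u, ∑ v, q u v x := by
      intro c x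
      have h1 : ∑ u, ∑ v, (1 - L u / c) * q u v x
          = ∑ u, ∑ v, q u v x - (∑ u, L u * ∑ v, q u v x) / c := by
        rw [sum_div, ← sum_sub_distrib]
        refine sum_congr rfl fun u _ => ?_
        rw [← mul_sum]; ring
      rw [h1, hL x]; simp
    have hw : ∀ u, 0 ≤ 1 - L u / L u₁ := fun u =>
      sub_nonneg.2 ((div_le_one hmax).2 (hu₁ u (mem_univ u)))
    have hw' : ∀ u, 0 ≤ 1 - L u / L u₂ := fun u =>
      sub_nonneg.2 ((div_le_one_of_neg hmin).2 (hu₂ u (mem_univ u)))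
    have bounded : ∀ u₀, L u₀ ≠ 0 → (∀ u, 0 ≤ 1 - L u / L u₀) →
        MartonSumBounded F₁ F₂ (fun u v x => (1 - L u / L u₀) * q u v x) := by
      intro u₀ h0 hnn
      refine (martonSumBounded_removeRow u₀ (by simp [div_self h0])).1 (H _ ?_ ?_)
      · exact fun u v x => mul_nonneg (hnn _) (hq _ _ _)
      · exact fun u => hR _ _ (hqR _)
    have B₁ := bounded u₁ hmax.ne' hw
    have B₂ := bounded u₂ hmin.ne hw'
    have hD : 0 < L u₁ - L u₂ := by linarith
    have ht : 0 ≤ L u₁ / (L u₁ - L u₂) := div_nonneg hmax.le hD.le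
    have ht' : 0 ≤ -L u₂ / (L u₁ - L u₂) := div_nonneg (by linarith) hD.le
    have htt : L u₁ / (L u₁ - L u₂) + -L u₂ / (L u₁ - L u₂) = 1 := by
      rw [← add_div, ← sub_eq_add_neg, div_self hD.ne']
    have key := martonSum_le_of_convex_combination (F₁ := F₁) (F₂ := F₂) hq hw hw' ht ht' htt
      (fun u => by
        have := hmax.ne'; have := hmin.ne; have := hD.ne'
        field_simp; ring) (mass _) (mass _)
    unfold MartonSumBounded at B₁ B₂ ⊢
    simp only [mass] at B₁ B₂
    set Z := max (chInfo F₁ (∑ u, ∑ v, q u v 0) (∑ u, ∑ v, q u v 1))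
      (chInfo F₂ (∑ u, ∑ v, q u v 0) (∑ u, ∑ v, q u v 1))
    calc _ ≤ _ := key
      _ ≤ L u₁ / (L u₁ - L u₂) * Z + -L u₂ / (L u₁ - L u₂) * Z :=
        add_le_add (mul_le_mul_of_nonneg_left B₁ ht) (mul_le_mul_of_nonneg_left B₂ ht')
      _ = Z := by rw [← add_mul, htt, one_mul]
  intro k
  rcases le_total k 2 with h | h
  · interval_cases k
    · exact pad 0 (pad 1 base)
    · exact pad 1 base
    · exact base
  · induction k, h using Nat.le_induction with
    | base => exact base
    | succ k hk ih => exact step k hk ih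

end Reduction

/-! ### Making the input a function of the auxiliary variables -/

section Determinization

variable {𝒴₁ 𝒴₂ : Type} [Fintype 𝒴₁] [Fintype 𝒴₂] {F₁ : DMC (Fin 2) 𝒴₁} {F₂ : DMC (Fin 2) 𝒴₂}

/-- The functional representation: refining `U` by independent randomness that determines the
input does not decrease `I(U;Y₁) + I(V;Y₂) - I(U;V)`. -/
lemma martonSumBounded_of_refinement {A B S : Type} [Fintype A] [Fintype B] [Fintype S]
    {q : A → B → Fin 2 → ℝ} (p : A → S → ℝ) (q' : A × S → B → Fin 2 → ℝ)
    (hq' : ∀ a v x, 0 ≤ q' a v x) (hp : ∀ u, ∑ c, p u c = 1)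
    (hsum : ∀ u v x, ∑ c, q' (u, c) v x = q u v x)
    (hind : ∀ u c v, q' (u, c) v 0 + q' (u, c) v 1 = p u c * (q u v 0 + q u v 1))
    (h : MartonSumBounded F₁ F₂ q') : MartonSumBounded F₁ F₂ q := by
  have hcol : ∀ v x, ∑ a, q' a v x = ∑ u, q u v x := fun v x => by
    rw [Fintype.sum_prod_type]; exact sum_congr rfl fun u _ => hsum u v x
  have hrow : ∀ u x, ∑ c, ∑ v, q' (u, c) v x = ∑ v, q u v x := fun u x => by
    rw [sum_comm]; exact sum_congr rfl fun v _ => hsum u v x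
  have htot : ∀ x, ∑ a, ∑ v, q' a v x = ∑ u, ∑ v, q u v x := fun x => by
    rw [Fintype.sum_prod_type]; exact sum_congr rfl fun u _ => hrow u x
  have hinfo : ∑ a, chInfo F₁ (∑ v, q' a v 0) (∑ v, q' a v 1)
      ≤ ∑ u, chInfo F₁ (∑ v, q u v 0) (∑ v, q u v 1) := by
    rw [Fintype.sum_prod_type]
    refine sum_le_sum fun u _ => ?_
    rw [← hrow, ← hrow]
    exact sum_chInfo_le F₁ (fun c => sum_nonneg fun v _ => hq' _ _ _)
      fun c => sum_nonneg fun v _ => hq' _ _ _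
  have hmat : matInfo (fun a v => q' a v 0 + q' a v 1)
      = matInfo fun u v => q u v 0 + q u v 1 := by
    have h1 : ∑ a, ent (∑ v, (q' a v 0 + q' a v 1)) - ∑ a, ∑ v, ent (q' a v 0 + q' a v 1)
        = ∑ u, ent (∑ v, (q u v 0 + q u v 1)) - ∑ u, ∑ v, ent (q u v 0 + q u v 1) := by
      rw [← sum_sub_distrib, ← sum_sub_distrib, Fintype.sum_prod_type]
      refine sum_congr rfl fun u _ => ?_
      simp only [hind, ← mul_sum, ent_mul]
      simp only [sum_add_distrib, ← sum_mul, ← mul_sum]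
      simp only [add_sub_add_left_eq_sub, ← mul_sub, ← sum_mul, hp, one_mul]
    have h2 : ∀ v, ∑ a, (q' a v 0 + q' a v 1) = ∑ u, (q u v 0 + q u v 1) := fun v => by
      rw [sum_add_distrib, sum_add_distrib, hcol, hcol]
    have h3 : ∑ a, ∑ v, (q' a v 0 + q' a v 1) = ∑ u, ∑ v, (q u v 0 + q u v 1) := by
      simp only [sum_add_distrib, htot]
    unfold matInfo
    simp only [h2, h3]
    linarith
  unfold MartonSumBounded martonSum at *
  rw [hmat] at h
  simp only [hcol, htot] at h
  linarith

/-- `U` is refined by a random table `v ↦ x`, drawn given `U` independently of `V`, whose entry at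
`V` is the input. `I(U;V)` is unchanged and `I(U;Y₁)` does not decrease. Determinism is a property
of each row that survives scaling, so it persists when the refined alphabet is then reduced to two
letters. -/
lemma martonSumBounded_of_binary_snd (s₁ : ∀ a b, chInfo F₁ a b = chInfo F₁ b a)
    (s₂ : ∀ a b, chInfo F₂ a b = chInfo F₂ b a) {A : Type} [Fintype A]
    {q : A → Fin 2 → Fin 2 → ℝ}
    (hq : ∀ u v x, 0 ≤ q u v x) : MartonSumBounded F₁ F₂ q := by
  have hdet : ∀ {A : Type} [Fintype A] (q : A → Fin 2 → Fin 2 → ℝ), (∀ u v x, 0 ≤ q u v x) →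
      (∀ u v, q u v 0 = 0 ∨ q u v 1 = 0) → MartonSumBounded F₁ F₂ q := by
    intro A _ q hq hd
    rw [← martonSumBounded_reindex_fst (Fintype.equivFin A).symm]
    refine martonSumBounded_reduce_fst (fun ν => ∀ v, ν v 0 = 0 ∨ ν v 1 = 0) ?_
      (fun q => martonSumBounded_of_deterministic s₁ s₂) (by simp) _ _
      (fun u v x => hq _ _ _) fun u => hd _
    intro ν c h v
    rcases h v with h | h <;> simp [h]
  set n : A → Fin 2 → ℝ := fun u v => q u v 0 + q u v 1 with hn
  have hn0 : ∀ u v, 0 ≤ n u v := fun u v => add_nonneg (hq u v 0) (hq u v 1)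
  -- The conditional law of `X` given `(U,V)`; on null cells a point mass at `0`, so that every row
  -- still sums to one.
  set w : A → Fin 2 → Fin 2 → ℝ := fun u v x =>
    if n u v = 0 then (if x = 0 then 1 else 0) else q u v x / n u v with hw
  have hw0 : ∀ u v x, 0 ≤ w u v x := by
    intro u v x
    simp only [hw]
    split_ifs
    exacts [zero_le_one, le_rfl, div_nonneg (hq u v x) (hn0 u v)]
  have hw1 : ∀ u v, w u v 0 + w u v 1 = 1 := by
    intro u v
    by_cases h : n u v = 0
    · simp [hw, h]
    · simp only [hw, if_neg h]
      rw [← add_div, div_self h]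
  have hwn : ∀ u v x, w u v x * n u v = q u v x := by
    intro u v x
    simp only [hw]
    split_ifs with h h'
    · have : q u v 0 + q u v 1 = 0 := h
      rw [h, h']; linarith [hq u v 0, hq u v 1]
    · have : q u v 0 + q u v 1 = 0 := h
      have h1 : x = 1 := by omega
      rw [h, h1]; linarith [hq u v 0, hq u v 1]
    · field_simp
  refine martonSumBounded_of_refinement (S := Fin 2 × Fin 2) (fun u c => w u 0 c.1 * w u 1 c.2)
    (fun a v x => w a.1 0 a.2.1 * w a.1 1 a.2.2 * if x = ![a.2.1, a.2.2] v then n a.1 v else 0)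
    ?_ ?_ ?_ ?_ (hdet _ ?_ ?_)
  · intro a v x
    refine mul_nonneg (mul_nonneg (hw0 _ _ _) (hw0 _ _ _)) ?_
    split_ifs
    exacts [hn0 _ _, le_rfl]
  · intro u
    simp only [Fintype.sum_prod_type, ← mul_sum, Fin.sum_univ_two, hw1]
    simpa using hw1 u 0
  · intro u v x
    rw [← hwn]
    have h0 := hw1 u 0
    have h1 := hw1 u 1
    fin_cases v <;> fin_cases x <;> simp [Fintype.sum_prod_type] <;>
      first
      | linear_combination (w u 0 0 * n u 0) * h1
      | linear_combination (w u 0 1 * n u 0) * h1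
      | linear_combination (w u 1 0 * n u 1) * h0
      | linear_combination (w u 1 1 * n u 1) * h0
  · intro u c v
    obtain ⟨i, j⟩ := c
    fin_cases v <;> fin_cases i <;> fin_cases j <;> simp [hn]
  · intro a v x
    refine mul_nonneg (mul_nonneg (hw0 _ _ _) (hw0 _ _ _)) ?_
    split_ifs
    exacts [hn0 _ _, le_rfl]
  · rintro ⟨u, i, j⟩ v
    fin_cases v <;> fin_cases i <;> fin_cases j <;> simp

/-- The inequality `I(U;Y₁) + I(V;Y₂) - I(U;V) ≤ max (I(X;Y₁)) (I(X;Y₂))` for a binary input. -/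
theorem martonSumBounded (s₁ : ∀ a b, chInfo F₁ a b = chInfo F₁ b a)
    (s₂ : ∀ a b, chInfo F₂ a b = chInfo F₂ b a) {A B : Type} [Fintype A]
    [Fintype B] {q : A → B → Fin 2 → ℝ}
    (hq : ∀ u v x, 0 ≤ q u v x) : MartonSumBounded F₁ F₂ q := by
  refine .of_swap ?_
  rw [← martonSumBounded_reindex_fst (Fintype.equivFin B).symm]
  refine martonSumBounded_reduce_fst (fun _ => True) (fun _ _ _ => trivial) (fun q hq _ => ?_)
    trivial _ _ (fun u v x => hq _ _ _) fun _ => trivial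
  exact .of_swap (martonSumBounded_of_binary_snd s₁ s₂ fun u v x => hq _ _ _)

end Determinization

/-! ### Information quantities in terms of `chInfo` and `matInfo` -/

lemma sum_rotate {A B D : Type} [Fintype A] [Fintype B] [Fintype D] (f : A → B → D → ℝ) :
    ∑ a, ∑ b, ∑ d, f a b d = ∑ d, ∑ a, ∑ b, f a b d := by
  rw [sum_comm (s := (univ : Finset D))]
  exact sum_congr rfl fun a _ => sum_comm

lemma law_eq {Ω A : Type} [Fintype Ω] [DecidableEq A] (P : Ω → ℝ) (Z : Ω → A) (a : A) : law P Z a = ∑ ω, if Z ω = a then P ω else 0 :=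
  sum_filter _ _

lemma sum_law_snd {Ω A B : Type} [Fintype Ω] [DecidableEq A] [Fintype B] [DecidableEq B]
    (P : Ω → ℝ) (Z : Ω → A) (Z' : Ω → B) (a : A) :
    ∑ b, law P (fun ω => (Z ω, Z' ω)) (a, b) = law P Z a := by
  simp only [law_eq]
  rw [sum_comm]
  refine sum_congr rfl fun ω _ => ?_
  by_cases h : Z ω = a <;> simp [h]

lemma sum_law_fst {Ω A B : Type} [Fintype Ω] [Fintype A] [DecidableEq A] [DecidableEq B]
    (P : Ω → ℝ) (Z : Ω → A) (Z' : Ω → B) (b : B) :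
    ∑ a, law P (fun ω => (Z ω, Z' ω)) (a, b) = law P Z' b := by
  simp only [law_eq]
  rw [sum_comm]
  refine sum_congr rfl fun ω _ => ?_
  by_cases h : Z' ω = b <;> simp [h]

section Law

variable {Ω A B D : Type} [Fintype Ω] [Fintype A] [DecidableEq A] [Fintype B] [DecidableEq B]
  [Fintype D] [DecidableEq D]

lemma entropy_eq (P : Ω → ℝ) (Z : Ω → A) : entropy P Z = ∑ a, ent (law P Z a) := by
  simp only [entropy, ent_eq, sum_neg_distrib]

lemma entropy_comp_equiv (P : Ω → ℝ) (Z : Ω → A) (e : A ≃ B) :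
    entropy P (fun ω => e (Z ω)) = entropy P Z := by
  rw [entropy_eq, entropy_eq, ← e.sum_comp]
  simp only [law_eq, e.apply_eq_iff_eq]

lemma sum_law (P : Ω → ℝ) (Z : Ω → A) : ∑ a, law P Z a = ∑ ω, P ω := by
  simp only [law_eq]
  rw [sum_comm]
  simp

lemma condMutualInfo_eq (P : Ω → ℝ) (Z : Ω → A) (Z' : Ω → B) (T : Ω → D) :
    condMutualInfo P Z Z' T
      = ∑ t, matInfo fun a b => law P (fun ω => (Z ω, Z' ω, T ω)) (a, b, t) := by
  have h1 : ∀ a t, ∑ b, law P (fun ω => (Z ω, Z' ω, T ω)) (a, b, t)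
      = law P (fun ω => (Z ω, T ω)) (a, t) := fun a t => by
    simp only [law_eq]
    rw [sum_comm]
    refine sum_congr rfl fun ω _ => ?_
    by_cases h : Z ω = a <;> by_cases h' : T ω = t <;> simp [h, h']
  have h2 : ∀ b t, ∑ a, law P (fun ω => (Z ω, Z' ω, T ω)) (a, b, t)
      = law P (fun ω => (Z' ω, T ω)) (b, t) := fun b t => sum_law_fst P Z (fun ω => (Z' ω, T ω)) _
  simp only [condMutualInfo, entropy_eq, matInfo, h1, h2, sum_law_fst, Fintype.sum_prod_type,
    sum_sub_distrib, sum_add_distrib]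
  rw [sum_comm (f := fun a t => ent (law P (fun ω => (Z ω, T ω)) (a, t))),
    sum_comm (f := fun b t => ent (law P (fun ω => (Z' ω, T ω)) (b, t)))]
  have h3 := sum_rotate fun a b t => ent (law P (fun ω => (Z ω, Z' ω, T ω)) (a, b, t))
  linarith

end Law

section OutInfo

variable {Ω 𝒴 A B : Type} [Fintype Ω] [Fintype 𝒴] [DecidableEq 𝒴]
  [Fintype A] [DecidableEq A] [Fintype B] [DecidableEq B]

lemma law_outputLaw_pair {Ω 𝒴 A : Type} [Fintype Ω] [Fintype 𝒴] [DecidableEq 𝒴] [DecidableEq A]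
    (q : Ω → ℝ) (X : Ω → Fin 2) (F : DMC (Fin 2) 𝒴) (Z : Ω → A) (z : A)
    (y : 𝒴) :
    law (outputLaw q X F) (fun p => (Z p.1, p.2)) (z, y)
      = law q (fun ω => (Z ω, X ω)) (z, 0) * F.prob 0 y
        + law q (fun ω => (Z ω, X ω)) (z, 1) * F.prob 1 y := by
  simp only [law_eq, Fintype.sum_prod_type, sum_mul, ← sum_add_distrib, outputLaw]
  refine sum_congr rfl fun ω _ => ?_
  by_cases h : Z ω = z
  · have : X ω = 0 ∨ X ω = 1 := by omega
    rcases this with h' | h' <;> simp [h, h']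
  · simp [h]

lemma law_outputLaw_fst {Ω 𝒴 A : Type} [Fintype Ω] [Fintype 𝒴] [DecidableEq 𝒴] [DecidableEq A]
    (q : Ω → ℝ) (X : Ω → Fin 2) (F : DMC (Fin 2) 𝒴) (Z : Ω → A) (z : A) :
    law (outputLaw q X F) (fun p => Z p.1) z
      = law q (fun ω => (Z ω, X ω)) (z, 0) + law q (fun ω => (Z ω, X ω)) (z, 1) := by
  rw [← sum_law_snd _ _ (fun p : Ω × 𝒴 => p.2)]
  simp only [law_outputLaw_pair, sum_add_distrib, ← mul_sum, F.prob_sum, mul_one]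

lemma law_outputLaw_snd (q : Ω → ℝ) (X : Ω → Fin 2) (F : DMC (Fin 2) 𝒴) (y : 𝒴) :
    law (outputLaw q X F) (fun p => p.2) y
      = law q X 0 * F.prob 0 y + law q X 1 * F.prob 1 y := by
  rw [← sum_law_fst _ (fun p : Ω × 𝒴 => X p.1)]
  simp only [law_outputLaw_pair, sum_add_distrib, ← sum_mul, sum_law_fst]

lemma outInfo_eq {q : Ω → ℝ} (hq : ∑ ω, q ω = 1) (X : Ω → Fin 2) (F : DMC (Fin 2) 𝒴) (Z : Ω → A) :
    outInfo q X F Z = chInfo F (law q X 0) (law q X 1)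
      - ∑ z, chInfo F (law q (fun ω => (Z ω, X ω)) (z, 0)) (law q (fun ω => (Z ω, X ω)) (z, 1)) := by
  have h1 : law q X 0 + law q X 1 = 1 := by
    rw [← hq, ← sum_law q X, Fin.sum_univ_two]
  simp only [outInfo, mutualInfo, entropy_eq, Fintype.sum_prod_type, law_outputLaw_pair,
    law_outputLaw_fst, law_outputLaw_snd, chInfo, h1, ent_one, sum_sub_distrib, ← sum_mul,
    sum_law_fst]
  ring

lemma condOutInfo_eq (q : Ω → ℝ) (X : Ω → Fin 2) (F : DMC (Fin 2) 𝒴) (Z : Ω → A) (T : Ω → B) :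
    condOutInfo q X F Z T
      = ∑ t, chInfo F (law q (fun ω => (T ω, X ω)) (t, 0)) (law q (fun ω => (T ω, X ω)) (t, 1))
        - ∑ z, ∑ t, chInfo F (law q (fun ω => ((Z ω, T ω), X ω)) ((z, t), 0))
            (law q (fun ω => ((Z ω, T ω), X ω)) ((z, t), 1)) := by
  have e1 : entropy (outputLaw q X F) (fun p => (p.2, T p.1))
      = entropy (outputLaw q X F) (fun p => (T p.1, p.2)) :=
    entropy_comp_equiv _ (fun p : Ω × 𝒴 => (T p.1, p.2)) (Equiv.prodComm _ _)
  have e2 : entropy (outputLaw q X F) (fun p => (Z p.1, p.2, T p.1))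
      = entropy (outputLaw q X F) (fun p => ((Z p.1, T p.1), p.2)) :=
    entropy_comp_equiv _ (fun p : Ω × 𝒴 => ((Z p.1, T p.1), p.2))
      ((Equiv.prodAssoc _ _ _).trans ((Equiv.refl _).prodCongr (Equiv.prodComm _ _)))
  have h : ∀ x, ∑ z, ∑ t, law q (fun ω => ((Z ω, T ω), X ω)) ((z, t), x)
      = ∑ t, law q (fun ω => (T ω, X ω)) (t, x) := fun x => by
    rw [sum_law_fst, ← Fintype.sum_prod_type (fun p => law q (fun ω => ((Z ω, T ω), X ω)) (p, x)),
      sum_law_fst]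
  unfold condOutInfo condMutualInfo
  rw [e1, e2, entropy_eq, entropy_eq, entropy_eq, entropy_eq]
  simp only [Fintype.sum_prod_type, law_outputLaw_pair _ _ _ T,
    law_outputLaw_pair _ _ _ (fun ω => (Z ω, T ω)), law_outputLaw_fst _ _ _ T,
    law_outputLaw_fst _ _ _ (fun ω => (Z ω, T ω)), chInfo, sum_sub_distrib, ← sum_mul, h]
  ring

end OutInfo

/-! ### The expressions in the two bounds as sums over joint laws -/

section Regions

variable {𝒴 : Type} [Fintype 𝒴] [DecidableEq 𝒴] {a b c : ℕ}

section Outer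

variable {q : Fin a × Fin b × Fin 2 → ℝ} (F : DMC (Fin 2) 𝒴)

lemma outInfo_outer_fst (hq : ∑ ω, q ω = 1) :
    outInfo q (fun ω => ω.2.2) F (fun ω => ω.1)
      = chInfo F (∑ u, ∑ v, q (u, v, 0)) (∑ u, ∑ v, q (u, v, 1))
        - ∑ u, chInfo F (∑ v, q (u, v, 0)) (∑ v, q (u, v, 1)) := by
  rw [outInfo_eq hq]
  simp [law_eq, Fintype.sum_prod_type]

lemma outInfo_outer_snd (hq : ∑ ω, q ω = 1) :
    outInfo q (fun ω => ω.2.2) F (fun ω => ω.2.1)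
      = chInfo F (∑ u, ∑ v, q (u, v, 0)) (∑ u, ∑ v, q (u, v, 1))
        - ∑ v, chInfo F (∑ u, q (u, v, 0)) (∑ u, q (u, v, 1)) := by
  rw [outInfo_eq hq]
  simp [law_eq, Fintype.sum_prod_type]

lemma condOutInfo_outer_fst :
    condOutInfo q (fun ω => ω.2.2) F (fun ω => ω.2.2) (fun ω => ω.1)
      = ∑ u, chInfo F (∑ v, q (u, v, 0)) (∑ v, q (u, v, 1)) := by
  rw [condOutInfo_eq]
  simp [law_eq, Fintype.sum_prod_type, ite_and, Fin.sum_univ_two]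

lemma condOutInfo_outer_snd :
    condOutInfo q (fun ω => ω.2.2) F (fun ω => ω.2.2) (fun ω => ω.2.1)
      = ∑ v, chInfo F (∑ u, q (u, v, 0)) (∑ u, q (u, v, 1)) := by
  rw [condOutInfo_eq]
  simp [law_eq, Fintype.sum_prod_type, ite_and, Fin.sum_univ_two]

end Outer

section Marton

variable {q : Fin a × Fin b × Fin c × Fin 2 → ℝ} (F : DMC (Fin 2) 𝒴)

lemma outInfo_marton_fst (hq : ∑ ω, q ω = 1) :
    outInfo q (fun ω => ω.2.2.2) F (fun ω => (ω.1, ω.2.2.1))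
      = chInfo F (∑ w, ∑ u, ∑ v, q (u, v, w, 0)) (∑ w, ∑ u, ∑ v, q (u, v, w, 1))
        - ∑ w, ∑ u, chInfo F (∑ v, q (u, v, w, 0)) (∑ v, q (u, v, w, 1)) := by
  rw [outInfo_eq hq, Fintype.sum_prod_type, sum_comm]
  simp [law_eq, Fintype.sum_prod_type, ite_and, sum_rotate fun u v w => q (u, v, w, _)]

lemma outInfo_marton_snd (hq : ∑ ω, q ω = 1) :
    outInfo q (fun ω => ω.2.2.2) F (fun ω => (ω.2.1, ω.2.2.1))
      = chInfo F (∑ w, ∑ u, ∑ v, q (u, v, w, 0)) (∑ w, ∑ u, ∑ v, q (u, v, w, 1))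
        - ∑ w, ∑ v, chInfo F (∑ u, q (u, v, w, 0)) (∑ u, q (u, v, w, 1)) := by
  rw [outInfo_eq hq, Fintype.sum_prod_type, sum_comm]
  simp [law_eq, Fintype.sum_prod_type, ite_and, sum_rotate fun u v w => q (u, v, w, _)]

lemma outInfo_marton_cloud (hq : ∑ ω, q ω = 1) :
    outInfo q (fun ω => ω.2.2.2) F (fun ω => ω.2.2.1)
      = chInfo F (∑ w, ∑ u, ∑ v, q (u, v, w, 0)) (∑ w, ∑ u, ∑ v, q (u, v, w, 1))
        - ∑ w, chInfo F (∑ u, ∑ v, q (u, v, w, 0)) (∑ u, ∑ v, q (u, v, w, 1)) := by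
  rw [outInfo_eq hq]
  simp [law_eq, Fintype.sum_prod_type, sum_rotate fun u v w => q (u, v, w, _)]

lemma condOutInfo_marton_fst :
    condOutInfo q (fun ω => ω.2.2.2) F (fun ω => ω.1) (fun ω => ω.2.2.1)
      = ∑ w, chInfo F (∑ u, ∑ v, q (u, v, w, 0)) (∑ u, ∑ v, q (u, v, w, 1))
        - ∑ w, ∑ u, chInfo F (∑ v, q (u, v, w, 0)) (∑ v, q (u, v, w, 1)) := by
  rw [condOutInfo_eq, sum_comm]
  simp [law_eq, Fintype.sum_prod_type, ite_and]

lemma condOutInfo_marton_snd :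
    condOutInfo q (fun ω => ω.2.2.2) F (fun ω => ω.2.1) (fun ω => ω.2.2.1)
      = ∑ w, chInfo F (∑ u, ∑ v, q (u, v, w, 0)) (∑ u, ∑ v, q (u, v, w, 1))
        - ∑ w, ∑ v, chInfo F (∑ u, q (u, v, w, 0)) (∑ u, q (u, v, w, 1)) := by
  rw [condOutInfo_eq, sum_comm]
  simp [law_eq, Fintype.sum_prod_type, ite_and]

lemma condMutualInfo_marton :
    condMutualInfo q (fun ω => ω.1) (fun ω => ω.2.1) (fun ω => ω.2.2.1)
      = ∑ w, matInfo fun u v => q (u, v, w, 0) + q (u, v, w, 1) := by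
  rw [condMutualInfo_eq]
  simp [law_eq, Fintype.sum_prod_type, ite_and, sum_add_distrib]

lemma martonSum_eq {𝒴' : Type} [Fintype 𝒴'] [DecidableEq 𝒴'] (F' : DMC (Fin 2) 𝒴') :
    condOutInfo q (fun ω => ω.2.2.2) F (fun ω => ω.1) (fun ω => ω.2.2.1)
      + condOutInfo q (fun ω => ω.2.2.2) F' (fun ω => ω.2.1) (fun ω => ω.2.2.1)
      - condMutualInfo q (fun ω => ω.1) (fun ω => ω.2.1) (fun ω => ω.2.2.1)
      = ∑ w, martonSum F F' fun u v x => q (u, v, w, x) := by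
  rw [condOutInfo_marton_fst, condOutInfo_marton_snd, condMutualInfo_marton]
  simp only [martonSum, sum_add_distrib, sum_sub_distrib]

end Marton

end Regions

/-! ### Symmetry, capacity and the BSC curve -/

section Capacity

/-- Averaging an input law with its reflection gives the uniform law and, by superadditivity and
symmetry, does not decrease the information. -/
lemma chInfo_le_uniform {𝒴 : Type} [Fintype 𝒴] {F : DMC (Fin 2) 𝒴}
    (s : ∀ a b, chInfo F a b = chInfo F b a) {a b : ℝ} (ha : 0 ≤ a) (hb : 0 ≤ b) :
    chInfo F a b ≤ (a + b) * chInfo F (1 / 2) (1 / 2) := by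
  have h := chInfo_add_le F ha hb hb ha
  rw [s b a, add_comm b a] at h
  have h2 := chInfo_mul F (2 * (a + b)) (1 / 2) (1 / 2)
  rw [show 2 * (a + b) * (1 / 2) = a + b by ring] at h2
  linarith

variable {𝒴 : Type} [Fintype 𝒴] [DecidableEq 𝒴] {F : DMC (Fin 2) 𝒴}

lemma info_eq {p : Fin 2 → ℝ} (hp : p ∈ stdSimplex ℝ (Fin 2)) : F.info p = chInfo F (p 0) (p 1) := by
  rw [DMC.info, outInfo_eq hp.2]
  simp [law_eq, Fin.sum_univ_two]

lemma chInfo_comm_of_isBISO {l : ℕ} {F : DMC (Fin 2) (SymAlphabet l)} (hF : F.IsBISO) (a b : ℝ) :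
    chInfo F a b = chInfo F b a := by
  have hneg : ∀ k : SymAlphabet l, -(k : ℤ) ∈ Finset.Icc (-(l : ℤ)) l := fun k => by
    have := Finset.mem_Icc.1 k.2
    exact Finset.mem_Icc.2 ⟨by omega, by omega⟩
  let e : SymAlphabet l ≃ SymAlphabet l :=
    ⟨fun k => ⟨-k, hneg k⟩, fun k => ⟨-k, hneg k⟩, fun k => by simp, fun k => by simp⟩
  have h0 : ∀ k, F.prob 0 k = F.prob 1 (e k) := fun k => hF k (e k) rfl
  have h1 : ∀ k, F.prob 1 k = F.prob 0 (e k) := fun k => by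
    rw [h0]; congr 1; exact (e.left_inv k).symm
  rw [chInfo_eq, chInfo_eq, binEnt_comm, ← e.sum_comp]
  simp only [← h0, ← h1]
  congr 1
  exact sum_congr rfl fun k _ => binEnt_comm _ _

lemma capacity_eq (s : ∀ a b, chInfo F a b = chInfo F b a) : F.capacity = chInfo F (1 / 2) (1 / 2) := by
  refine IsGreatest.csSup_eq ⟨⟨fun _ => 1 / 2, ⟨fun _ => by norm_num, by norm_num⟩, ?_⟩, ?_⟩
  · rw [info_eq ⟨fun _ => by norm_num, by norm_num⟩]
  · rintro _ ⟨p, hp, rfl⟩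
    rw [info_eq hp]
    have h := chInfo_le_uniform s (hp.1 0) (hp.1 1)
    have h1 : p 0 + p 1 = 1 := by rw [← hp.2, Fin.sum_univ_two]
    rwa [h1, one_mul] at h

lemma bscInfo_eq (s : ∀ a b, chInfo F a b = chInfo F b a) (t : ℝ) :
    bscInfo F t = chInfo F (1 / 2) (1 / 2) - chInfo F (1 - t) t := by
  have h1 : ∑ ω, bscLaw t ω = 1 := by
    simp [bscLaw, Fintype.sum_prod_type, Fin.sum_univ_two]; ring
  have h2 := chInfo_mul F (1 / 2) (1 - t) t
  have h3 := s (1 / 2 * t) (1 / 2 * (1 - t))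
  have e1 : (1 / 2 : ℝ) * (1 - t) + 1 / 2 * t = 1 / 2 := by ring
  have e2 : (1 / 2 : ℝ) * t + 1 / 2 * (1 - t) = 1 / 2 := by ring
  rw [bscInfo, outInfo_eq h1]
  simp only [law_eq, bscLaw, Fintype.sum_prod_type, Fin.sum_univ_two, Prod.mk.injEq]
  simp only [reduceIte, Fin.isValue, one_ne_zero, zero_ne_one, and_true, and_false, add_zero,
    zero_add, e1, e2]
  linarith

end Capacity

/-! ### The rate regions -/

section Regions

variable {𝒴₁ 𝒴₂ : Type} [Fintype 𝒴₁] [DecidableEq 𝒴₁] [Fintype 𝒴₂] [DecidableEq 𝒴₂]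
  {F₁ : DMC (Fin 2) 𝒴₁} {F₂ : DMC (Fin 2) 𝒴₂}

/-- Arbitrary finite alphabets are allowed so that auxiliary variables can be pairs. -/
lemma mem_outerBound {A B : Type} [Fintype A] [Fintype B] (q : A → B → Fin 2 → ℝ)
    (hq : ∀ u v x, 0 ≤ q u v x) (hq1 : ∑ u, ∑ v, ∑ x, q u v x = 1) {R : ℝ × ℝ}
    (h1 : 0 ≤ R.1) (h2 : 0 ≤ R.2)
    (h3 : R.1 ≤ chInfo F₁ (∑ u, ∑ v, q u v 0) (∑ u, ∑ v, q u v 1)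
      - ∑ u, chInfo F₁ (∑ v, q u v 0) (∑ v, q u v 1))
    (h4 : R.2 ≤ chInfo F₂ (∑ u, ∑ v, q u v 0) (∑ u, ∑ v, q u v 1)
      - ∑ v, chInfo F₂ (∑ u, q u v 0) (∑ u, q u v 1))
    (h5 : R.1 + R.2 ≤ chInfo F₁ (∑ u, ∑ v, q u v 0) (∑ u, ∑ v, q u v 1)
      - ∑ u, chInfo F₁ (∑ v, q u v 0) (∑ v, q u v 1)
      + ∑ u, chInfo F₂ (∑ v, q u v 0) (∑ v, q u v 1))
    (h6 : R.1 + R.2 ≤ chInfo F₂ (∑ u, ∑ v, q u v 0) (∑ u, ∑ v, q u v 1)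
      - ∑ v, chInfo F₂ (∑ u, q u v 0) (∑ u, q u v 1)
      + ∑ v, chInfo F₁ (∑ u, q u v 0) (∑ u, q u v 1)) :
    R ∈ outerBound F₁ F₂ := by
  set e := (Fintype.equivFin A).symm
  set e' := (Fintype.equivFin B).symm
  set q' : Fin (Fintype.card A) × Fin (Fintype.card B) × Fin 2 → ℝ :=
    fun ω => q (e ω.1) (e' ω.2.1) ω.2.2 with hq'
  have hsum : ∑ ω, q' ω = 1 := by
    simp only [hq', Fintype.sum_prod_type]
    rw [e.sum_comp fun u => ∑ v, ∑ x, q u (e' v) x]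
    rw [← hq1]
    exact sum_congr rfl fun u _ => e'.sum_comp fun v => ∑ x, q u v x
  have hu : ∀ u x, ∑ v, q (e u) (e' v) x = ∑ v, q (e u) v x := fun u x =>
    e'.sum_comp fun v => q (e u) v x
  have hv : ∀ v x, ∑ u, q (e u) (e' v) x = ∑ u, q u (e' v) x := fun v x =>
    e.sum_comp fun u => q u (e' v) x
  have ht : ∀ x, ∑ u, ∑ v, q (e u) v x = ∑ u, ∑ v, q u v x := fun x =>
    e.sum_comp fun u => ∑ v, q u v x
  have hcu : ∀ {𝒴 : Type} [Fintype 𝒴] (F : DMC (Fin 2) 𝒴),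
      ∑ u, chInfo F (∑ v, q (e u) v 0) (∑ v, q (e u) v 1)
        = ∑ u, chInfo F (∑ v, q u v 0) (∑ v, q u v 1) := fun F =>
    e.sum_comp fun u => chInfo F (∑ v, q u v 0) (∑ v, q u v 1)
  have hcv : ∀ {𝒴 : Type} [Fintype 𝒴] (F : DMC (Fin 2) 𝒴),
      ∑ v, chInfo F (∑ u, q u (e' v) 0) (∑ u, q u (e' v) 1)
        = ∑ v, chInfo F (∑ u, q u v 0) (∑ u, q u v 1) := fun F =>
    e'.sum_comp fun v => chInfo F (∑ u, q u v 0) (∑ u, q u v 1)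
  refine ⟨h1, h2, Fintype.card A, Fintype.card B, q', ⟨fun ω => hq _ _ _, hsum⟩, ?_⟩
  intro U V X
  have i1 := outInfo_outer_fst F₁ hsum
  have i2 := outInfo_outer_snd F₂ hsum
  have i3 := condOutInfo_outer_fst (q := q') F₂
  have i4 := condOutInfo_outer_snd (q := q') F₁
  simp only [hq', hu, hv, ht, hcu, hcv] at i1 i2 i3 i4
  exact ⟨h3.trans_eq i1.symm, h4.trans_eq i2.symm, by rw [i1, i3]; exact h5,
    by rw [i2, i4]; exact h6⟩

lemma mem_martonInnerBound {a b : ℕ} {D : Type} [Fintype D] (q : D → Fin a → Fin b → Fin 2 → ℝ)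
    (hq : ∀ w u v x, 0 ≤ q w u v x) (hq1 : ∑ u, ∑ v, ∑ w, ∑ x, q w u v x = 1) {R : ℝ × ℝ}
    (h1 : 0 ≤ R.1) (h2 : 0 ≤ R.2)
    (h3 : R.1 ≤ chInfo F₁ (∑ w, ∑ u, ∑ v, q w u v 0) (∑ w, ∑ u, ∑ v, q w u v 1)
      - ∑ w, ∑ u, chInfo F₁ (∑ v, q w u v 0) (∑ v, q w u v 1))
    (h4 : R.2 ≤ chInfo F₂ (∑ w, ∑ u, ∑ v, q w u v 0) (∑ w, ∑ u, ∑ v, q w u v 1)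
      - ∑ w, ∑ v, chInfo F₂ (∑ u, q w u v 0) (∑ u, q w u v 1))
    (h5 : R.1 + R.2 ≤ min
      (chInfo F₁ (∑ w, ∑ u, ∑ v, q w u v 0) (∑ w, ∑ u, ∑ v, q w u v 1)
        - ∑ w, chInfo F₁ (∑ u, ∑ v, q w u v 0) (∑ u, ∑ v, q w u v 1))
      (chInfo F₂ (∑ w, ∑ u, ∑ v, q w u v 0) (∑ w, ∑ u, ∑ v, q w u v 1)
        - ∑ w, chInfo F₂ (∑ u, ∑ v, q w u v 0) (∑ u, ∑ v, q w u v 1))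
      + ∑ w, martonSum F₁ F₂ (q w)) :
    R ∈ martonInnerBound F₁ F₂ := by
  set e := (Fintype.equivFin D).symm
  set q' : Fin a × Fin b × Fin (Fintype.card D) × Fin 2 → ℝ :=
    fun ω => q (e ω.2.2.1) ω.1 ω.2.1 ω.2.2.2 with hq'
  have hsum : ∑ ω, q' ω = 1 := by
    simp only [hq', Fintype.sum_prod_type]
    rw [← hq1]
    exact sum_congr rfl fun u _ => sum_congr rfl fun v _ => e.sum_comp fun w => ∑ x, q w u v x
  refine ⟨h1, h2, a, b, Fintype.card D, q', ⟨fun ω => hq _ _ _ _, hsum⟩, ?_⟩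
  intro U V W X
  have i1 := outInfo_marton_fst F₁ hsum
  have i2 := outInfo_marton_snd F₂ hsum
  have i3 := outInfo_marton_cloud F₁ hsum
  have i4 := outInfo_marton_cloud F₂ hsum
  have i5 := martonSum_eq (q := q') F₁ F₂
  simp only [hq'] at i1 i2 i3 i4 i5
  rw [e.sum_comp fun w => ∑ u, ∑ v, q w u v 0, e.sum_comp fun w => ∑ u, ∑ v, q w u v 1] at i1 i2 i3 i4
  rw [e.sum_comp fun w => ∑ u, chInfo F₁ (∑ v, q w u v 0) (∑ v, q w u v 1)] at i1
  rw [e.sum_comp fun w => ∑ v, chInfo F₂ (∑ u, q w u v 0) (∑ u, q w u v 1)] at i2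
  rw [e.sum_comp fun w => chInfo F₁ (∑ u, ∑ v, q w u v 0) (∑ u, ∑ v, q w u v 1)] at i3
  rw [e.sum_comp fun w => chInfo F₂ (∑ u, ∑ v, q w u v 0) (∑ u, ∑ v, q w u v 1)] at i4
  rw [e.sum_comp fun w => martonSum F₁ F₂ (q w)] at i5
  refine ⟨h3.trans_eq i1.symm, h4.trans_eq i2.symm, ?_⟩
  rw [← i3, ← i4, ← i5] at h5
  refine h5.trans_eq ?_
  rw [← add_sub_assoc, ← add_assoc]

lemma martonInnerBound_subset_outerBound (F₁ : DMC (Fin 2) 𝒴₁) (F₂ : DMC (Fin 2) 𝒴₂) :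
    martonInnerBound F₁ F₂ ⊆ outerBound F₁ F₂ := by
  rintro R ⟨h1, h2, a, b, c, q, ⟨hq, hq1⟩, h⟩
  obtain ⟨h3, h4, h5⟩ := h
  have i5 := martonSum_eq (q := q) F₁ F₂
  rw [add_sub_assoc, add_assoc, ← add_sub_assoc, i5] at h5
  rw [outInfo_marton_fst F₁ hq1] at h3
  rw [outInfo_marton_snd F₂ hq1] at h4
  rw [outInfo_marton_cloud F₁ hq1, outInfo_marton_cloud F₂ hq1] at h5
  -- The joint law of `((U,W), (V,W), X)`. For the sum rates, `chInfo_sub_matInfo_le` is used for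
  -- each value of `W`, with either branch of the minimum.
  set q' : Fin a × Fin c → Fin b × Fin c → Fin 2 → ℝ := fun i j x =>
    if j.2 = i.2 then q (i.1, j.1, i.2, x) else 0 with hq'
  have hrow : ∀ u w x, ∑ j, q' (u, w) j x = ∑ v, q (u, v, w, x) := fun u w x => by
    simp [hq', Fintype.sum_prod_type]
  have hcol : ∀ v w x, ∑ i, q' i (v, w) x = ∑ u, q (u, v, w, x) := fun v w x => by
    simp [hq', Fintype.sum_prod_type]
  have htot : ∀ x, ∑ i, ∑ j, q' i j x = ∑ w, ∑ u, ∑ v, q (u, v, w, x) := fun x => by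
    rw [Fintype.sum_prod_type, sum_comm]
    simp only [hrow]
  have hr : ∀ {𝒴 : Type} [Fintype 𝒴] (F : DMC (Fin 2) 𝒴),
      ∑ i, chInfo F (∑ j, q' i j 0) (∑ j, q' i j 1)
        = ∑ w, ∑ u, chInfo F (∑ v, q (u, v, w, 0)) (∑ v, q (u, v, w, 1)) := fun F => by
    rw [Fintype.sum_prod_type, sum_comm]
    simp only [hrow]
  have hc : ∀ {𝒴 : Type} [Fintype 𝒴] (F : DMC (Fin 2) 𝒴),
      ∑ j, chInfo F (∑ i, q' i j 0) (∑ i, q' i j 1)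
        = ∑ w, ∑ v, chInfo F (∑ u, q (u, v, w, 0)) (∑ u, q (u, v, w, 1)) := fun F => by
    rw [Fintype.sum_prod_type, sum_comm]
    simp only [hcol]
  have b1 : ∑ w, martonSum F₁ F₂ (fun u v x => q (u, v, w, x))
      ≤ ∑ w, (chInfo F₁ (∑ u, ∑ v, q (u, v, w, 0)) (∑ u, ∑ v, q (u, v, w, 1))
        - ∑ u, chInfo F₁ (∑ v, q (u, v, w, 0)) (∑ v, q (u, v, w, 1))
        + ∑ u, chInfo F₂ (∑ v, q (u, v, w, 0)) (∑ v, q (u, v, w, 1))) :=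
    sum_le_sum fun w _ => by
      have := chInfo_sub_matInfo_le F₂ (q := fun u v x => q (u, v, w, x)) fun u v x => hq _
      unfold martonSum
      linarith
  have b2 : ∑ w, martonSum F₁ F₂ (fun u v x => q (u, v, w, x))
      ≤ ∑ w, (chInfo F₂ (∑ u, ∑ v, q (u, v, w, 0)) (∑ u, ∑ v, q (u, v, w, 1))
        - ∑ v, chInfo F₂ (∑ u, q (u, v, w, 0)) (∑ u, q (u, v, w, 1))
        + ∑ v, chInfo F₁ (∑ u, q (u, v, w, 0)) (∑ u, q (u, v, w, 1))) :=
    sum_le_sum fun w _ => by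
      have := chInfo_sub_matInfo_le F₁ (q := fun v u x => q (u, v, w, x)) fun v u x => hq _
      rw [matInfo_swap (fun u v => q (u, v, w, 0) + q (u, v, w, 1)),
        sum_comm (f := fun v u => q (u, v, w, 0)), sum_comm (f := fun v u => q (u, v, w, 1))] at this
      unfold martonSum
      linarith
  simp only [sum_add_distrib, sum_sub_distrib] at b1 b2
  refine mem_outerBound q' (fun i j x => ?_) ?_ h1 h2 ?_ ?_ ?_ ?_
  · simp only [hq']; split_ifs; exacts [hq _, le_rfl]
  · have : ∑ i, ∑ j, ∑ x, q' i j x = ∑ x, ∑ i, ∑ j, q' i j x := sum_rotate _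
    rw [this]
    simp only [htot]
    rw [← hq1]
    simp only [Fintype.sum_prod_type]
    rw [sum_comm, sum_rotate fun u v w => ∑ x, q (u, v, w, x)]
    refine sum_congr rfl fun w _ => ?_
    exact (sum_rotate _).symm
  all_goals simp only [htot, hr, hc]
  · exact h3
  · exact h4
  · have := min_le_left
      (chInfo F₁ (∑ w, ∑ u, ∑ v, q (u, v, w, 0)) (∑ w, ∑ u, ∑ v, q (u, v, w, 1))
        - ∑ w, chInfo F₁ (∑ u, ∑ v, q (u, v, w, 0)) (∑ u, ∑ v, q (u, v, w, 1)))
      (chInfo F₂ (∑ w, ∑ u, ∑ v, q (u, v, w, 0)) (∑ w, ∑ u, ∑ v, q (u, v, w, 1))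
        - ∑ w, chInfo F₂ (∑ u, ∑ v, q (u, v, w, 0)) (∑ u, ∑ v, q (u, v, w, 1)))
    linarith
  · have := min_le_right
      (chInfo F₁ (∑ w, ∑ u, ∑ v, q (u, v, w, 0)) (∑ w, ∑ u, ∑ v, q (u, v, w, 1))
        - ∑ w, chInfo F₁ (∑ u, ∑ v, q (u, v, w, 0)) (∑ u, ∑ v, q (u, v, w, 1)))
      (chInfo F₂ (∑ w, ∑ u, ∑ v, q (u, v, w, 0)) (∑ w, ∑ u, ∑ v, q (u, v, w, 1))
        - ∑ w, chInfo F₂ (∑ u, ∑ v, q (u, v, w, 0)) (∑ u, ∑ v, q (u, v, w, 1)))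
    linarith

end Regions

/-! ### Symmetric channels with a common capacity -/

/-- `I(X;Y)` when `P(X = 1) = s`. -/
noncomputable def inputInfo {𝒴 : Type} [Fintype 𝒴] (F : DMC (Fin 2) 𝒴) (s : ℝ) : ℝ :=
  chInfo F (1 - s) s

section InputInfo

variable {𝒴 : Type} [Fintype 𝒴] {F : DMC (Fin 2) 𝒴}

lemma continuous_inputInfo (F : DMC (Fin 2) 𝒴) : Continuous (inputInfo F) :=
  (continuous_chInfo F).comp (f := fun s : ℝ => (1 - s, s)) (by fun_prop)

lemma inputInfo_nonneg {s : ℝ} (hs : s ∈ Set.Icc (0 : ℝ) 1) : 0 ≤ inputInfo F s :=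
  chInfo_nonneg F (by linarith [hs.2]) hs.1

lemma inputInfo_zero : inputInfo F 0 = 0 := by simp [inputInfo]

lemma inputInfo_half : inputInfo F (1 / 2) = chInfo F (1 / 2) (1 / 2) := by
  norm_num [inputInfo]

lemma inputInfo_le (s : ∀ a b, chInfo F a b = chInfo F b a) {t : ℝ} (ht : t ∈ Set.Icc (0 : ℝ) 1) :
    inputInfo F t ≤ chInfo F (1 / 2) (1 / 2) := by
  have := chInfo_le_uniform s (by linarith [ht.2] : 0 ≤ 1 - t) ht.1
  rwa [sub_add_cancel, one_mul] at this

lemma chInfo_eq_mass_mul_inputInfo {a b : ℝ} (ha : 0 ≤ a) (hb : 0 ≤ b) :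
    chInfo F a b = (a + b) * inputInfo F (b / (a + b)) := by
  rcases (add_nonneg ha hb).eq_or_lt with h | h
  · have h1 : a = 0 := by linarith
    have h2 : b = 0 := by linarith
    simp [h1, h2]
  · rw [inputInfo, ← chInfo_mul]
    congr 1 <;> field_simp
    ring

/-- For `0 < s < 1` an output letter has probability zero only if both inputs give it probability
zero, and then its term is constant; otherwise the logarithm is analytic. -/
lemma analyticOnNhd_inputInfo (F : DMC (Fin 2) 𝒴) :
    AnalyticOnNhd ℝ (inputInfo F) (Set.Ioo 0 1) := by
  rintro s ⟨hs0, hs1⟩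
  have h : inputInfo F = fun s => ∑ y, ent ((1 - s) * F.prob 0 y + s * F.prob 1 y)
      - (1 - s) * ∑ y, ent (F.prob 0 y) - s * ∑ y, ent (F.prob 1 y) := by
    funext s; simp [inputInfo, chInfo]
  rw [h]
  have hent : ∀ y, AnalyticAt ℝ (fun s => ent ((1 - s) * F.prob 0 y + s * F.prob 1 y)) s := by
    intro y
    have hlin : AnalyticAt ℝ (fun s : ℝ => (1 - s) * F.prob 0 y + s * F.prob 1 y) s := by fun_prop
    rcases (F.prob_nonneg 0 y).eq_or_lt with h0 | h0
    · rcases (F.prob_nonneg 1 y).eq_or_lt with h1 | h1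
      · simp only [← h0, ← h1, mul_zero, add_zero]; exact analyticAt_const
      · have hpos : 0 < (1 - s) * F.prob 0 y + s * F.prob 1 y := by
          rw [← h0]; simpa using mul_pos hs0 h1
        exact (hlin.neg.mul (hlin.log hpos)).div_const
    · have hpos : 0 < (1 - s) * F.prob 0 y + s * F.prob 1 y :=
        add_pos_of_pos_of_nonneg (mul_pos (by linarith) h0) (mul_nonneg hs0.le (F.prob_nonneg 1 y))
      exact (hlin.neg.mul (hlin.log hpos)).div_const
  have hsum := Finset.analyticAt_fun_sum univ fun y _ => hent y
  fun_prop

lemma inputInfo_one_sub (h : ∀ a b, chInfo F a b = chInfo F b a) (s : ℝ) :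
    inputInfo F (1 - s) = inputInfo F s := by
  rw [inputInfo, inputInfo, sub_sub_cancel, h]

end InputInfo

section Difference

variable {𝒴₁ 𝒴₂ : Type} [Fintype 𝒴₁] [Fintype 𝒴₂] {F₁ : DMC (Fin 2) 𝒴₁} {F₂ : DMC (Fin 2) 𝒴₂}

lemma chInfo_sub_le_of_inputInfo_sub_le {d : ℝ}
    (h : ∀ s ∈ Set.Icc (0 : ℝ) 1, inputInfo F₂ s - inputInfo F₁ s ≤ d) {a b : ℝ} (ha : 0 ≤ a)
    (hb : 0 ≤ b) : chInfo F₂ a b - chInfo F₁ a b ≤ (a + b) * d := by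
  rw [chInfo_eq_mass_mul_inputInfo ha hb, chInfo_eq_mass_mul_inputInfo ha hb, ← mul_sub]
  refine mul_le_mul_of_nonneg_left (h _ ⟨?_, ?_⟩) (add_nonneg ha hb)
  · exact div_nonneg hb (add_nonneg ha hb)
  · exact div_le_one_of_le₀ (by linarith) (add_nonneg ha hb)

lemma martonSum_row (m : Fin 2 → ℝ) :
    martonSum F₁ F₂ (fun u v x : Fin 2 => if u = 0 ∧ v = x then m x else 0)
      = chInfo F₂ (m 0) (m 1) := by
  simp [martonSum, matInfo, Fin.sum_univ_two]

lemma martonSum_col (m : Fin 2 → ℝ) :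
    martonSum F₁ F₂ (fun u v x : Fin 2 => if v = 0 ∧ u = x then m x else 0)
      = chInfo F₁ (m 0) (m 1) := by
  simp [martonSum, matInfo, Fin.sum_univ_two]

end Difference

/-! ### Upper bounds on the sum rate and explicit auxiliary laws -/

section Pair

variable {𝒴₁ 𝒴₂ : Type} [Fintype 𝒴₁] [DecidableEq 𝒴₁] [Fintype 𝒴₂] [DecidableEq 𝒴₂]
  {F₁ : DMC (Fin 2) 𝒴₁} {F₂ : DMC (Fin 2) 𝒴₂}

lemma moreCapable_iff (s₁ : ∀ a b, chInfo F₁ a b = chInfo F₁ b a)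
    (s₂ : ∀ a b, chInfo F₂ a b = chInfo F₂ b a) :
    MoreCapable F₁ F₂ ↔ ∀ s ∈ Set.Icc (0 : ℝ) (1 / 2), inputInfo F₂ s ≤ inputInfo F₁ s := by
  constructor
  · intro h s hs
    have hp : ![1 - s, s] ∈ stdSimplex ℝ (Fin 2) :=
      ⟨by simp only [Fin.forall_fin_two, Matrix.cons_val_zero, Matrix.cons_val_one]
          exact ⟨by linarith [hs.2], hs.1⟩, by simp⟩
    have := h _ hp
    rwa [info_eq hp, info_eq hp] at this
  · intro h p hp
    have h1 : p 0 + p 1 = 1 := by rw [← hp.2, Fin.sum_univ_two]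
    rw [info_eq hp, info_eq hp, show p 0 = 1 - p 1 by linarith]
    change inputInfo F₂ (p 1) ≤ inputInfo F₁ (p 1)
    rcases le_total (p 1) (1 / 2) with h2 | h2
    · exact h _ ⟨hp.1 1, h2⟩
    · rw [← inputInfo_one_sub s₁, ← inputInfo_one_sub s₂]
      exact h _ ⟨by linarith [hp.1 0], by linarith⟩

lemma chInfo_le_of_moreCapable (h : MoreCapable F₁ F₂) {a b : ℝ} (ha : 0 ≤ a) (hb : 0 ≤ b) :
    chInfo F₂ a b ≤ chInfo F₁ a b := by
  have := chInfo_sub_le_of_inputInfo_sub_le (F₁ := F₁) (F₂ := F₂) (d := 0) (fun s hs => by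
    have hp : ![1 - s, s] ∈ stdSimplex ℝ (Fin 2) :=
      ⟨by simp only [Fin.forall_fin_two, Matrix.cons_val_zero, Matrix.cons_val_one]
          exact ⟨by linarith [hs.2], hs.1⟩, by simp⟩
    have := h _ hp
    rw [info_eq hp, info_eq hp] at this
    exact sub_nonpos.2 this) ha hb
  linarith

lemma mem_timeDivision {C : ℝ} (h₁ : F₁.capacity = C) (h₂ : F₂.capacity = C) {R : ℝ × ℝ} :
    R ∈ timeDivision F₁ F₂ ↔ 0 ≤ R.1 ∧ 0 ≤ R.2 ∧ R.1 + R.2 ≤ C := by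
  rw [timeDivision, Set.mem_ofPred_eq, h₁, h₂]
  refine and_congr_right fun hR1 => and_congr_right fun hR2 => ⟨?_, fun h => ?_⟩
  · rintro ⟨α, -, h1, h2⟩; linarith
  · rcases (by linarith : 0 ≤ C).eq_or_lt with hC | hC
    · exact ⟨0, ⟨le_rfl, zero_le_one⟩, by linarith, by linarith⟩
    · refine ⟨R.1 / C, ⟨div_nonneg hR1 hC.le, div_le_one_of_le₀ (by linarith) hC.le⟩, ?_, ?_⟩
      · field_simp; rfl
      · rw [sub_mul, one_mul, div_mul_cancel₀ _ hC.ne']; linarith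

/-- For more-capable comparable channels, the sum rate of the outer bound is at most `C`. -/
lemma sum_le_of_mem_outerBound (s₁ : ∀ a b, chInfo F₁ a b = chInfo F₁ b a)
    (s₂ : ∀ a b, chInfo F₂ a b = chInfo F₂ b a) {C : ℝ} (h₁ : chInfo F₁ (1 / 2) (1 / 2) = C)
    (h₂ : chInfo F₂ (1 / 2) (1 / 2) = C) (h : MoreCapableComparable F₁ F₂) {R : ℝ × ℝ}
    (hR : R ∈ outerBound F₁ F₂) : R.1 + R.2 ≤ C := by
  obtain ⟨-, -, a, b, q, ⟨hq, hq1⟩, -, -, h5, h6⟩ := hR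
  rw [outInfo_outer_fst F₁ hq1, condOutInfo_outer_fst] at h5
  rw [outInfo_outer_snd F₂ hq1, condOutInfo_outer_snd] at h6
  have hm : ∀ x, 0 ≤ ∑ u, ∑ v, q (u, v, x) := fun x =>
    sum_nonneg fun u _ => sum_nonneg fun v _ => hq _
  have hm1 : ∑ u, ∑ v, q (u, v, 0) + ∑ u, ∑ v, q (u, v, 1) = 1 := by
    rw [← hq1]
    simp only [Fintype.sum_prod_type, Fin.sum_univ_two, sum_add_distrib]
  have b1 := chInfo_le_uniform s₁ (hm 0) (hm 1)
  have b2 := chInfo_le_uniform s₂ (hm 0) (hm 1)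
  rw [hm1, one_mul, h₁] at b1
  rw [hm1, one_mul, h₂] at b2
  rcases h with h | h
  -- `I(U;Y₁) + I(X;Y₂|U) ≤ I(U;Y₁) + I(X;Y₁|U) = I(X;Y₁)`.
  · have := sum_le_sum fun u (_ : u ∈ (univ : Finset (Fin a))) =>
      chInfo_le_of_moreCapable h (sum_nonneg fun v (_ : v ∈ univ) => hq (u, v, 0))
        (sum_nonneg fun v (_ : v ∈ univ) => hq (u, v, 1))
    linarith
  · have := sum_le_sum fun v (_ : v ∈ (univ : Finset (Fin b))) =>
      chInfo_le_of_moreCapable h (sum_nonneg fun u (_ : u ∈ univ) => hq (u, v, 0))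
        (sum_nonneg fun u (_ : u ∈ univ) => hq (u, v, 1))
    linarith

/-- The sum rate of Marton's inner bound, for channels whose difference of mutual informations is
between `-d₂` and `d₁`. -/
lemma sum_le_of_mem_martonInnerBound (s₁ : ∀ a b, chInfo F₁ a b = chInfo F₁ b a)
    (s₂ : ∀ a b, chInfo F₂ a b = chInfo F₂ b a) {C d₁ d₂ : ℝ}
    (h₁ : chInfo F₁ (1 / 2) (1 / 2) = C) (h₂ : chInfo F₂ (1 / 2) (1 / 2) = C)
    (hd₁ : 0 < d₁) (hd₂ : 0 < d₂)
    (hD₁ : ∀ s ∈ Set.Icc (0 : ℝ) 1, inputInfo F₂ s - inputInfo F₁ s ≤ d₁)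
    (hD₂ : ∀ s ∈ Set.Icc (0 : ℝ) 1, inputInfo F₁ s - inputInfo F₂ s ≤ d₂) {R : ℝ × ℝ}
    (hR : R ∈ martonInnerBound F₁ F₂) : R.1 + R.2 ≤ C + d₁ * d₂ / (d₁ + d₂) := by
  obtain ⟨-, -, a, b, c, q, ⟨hq, hq1⟩, -, -, h5⟩ := hR
  have i5 := martonSum_eq (q := q) F₁ F₂
  rw [add_sub_assoc, add_assoc, ← add_sub_assoc, i5, outInfo_marton_cloud F₁ hq1,
    outInfo_marton_cloud F₂ hq1] at h5
  have hm : ∀ w x, 0 ≤ ∑ u, ∑ v, q (u, v, w, x) := fun w x =>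
    sum_nonneg fun u _ => sum_nonneg fun v _ => hq _
  have hM : ∀ x, 0 ≤ ∑ w, ∑ u, ∑ v, q (u, v, w, x) := fun x => sum_nonneg fun w _ => hm w x
  have hM1 : ∑ w, ∑ u, ∑ v, q (u, v, w, 0) + ∑ w, ∑ u, ∑ v, q (u, v, w, 1) = 1 := by
    rw [← hq1]
    simp only [Fintype.sum_prod_type, Fin.sum_univ_two, sum_add_distrib]
    rw [sum_rotate fun u v w => q (u, v, w, 0), sum_rotate fun u v w => q (u, v, w, 1)]
  have b1 := chInfo_le_uniform s₁ (hM 0) (hM 1)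
  have b2 := chInfo_le_uniform s₂ (hM 0) (hM 1)
  rw [hM1, one_mul, h₁] at b1
  rw [hM1, one_mul, h₂] at b2
  have hd : 0 < d₁ + d₂ := add_pos hd₁ hd₂
  -- The weight that balances `θ * d₁ = (1 - θ) * d₂ = T`: per unit mass, the maximum of the two
  -- informations exceeds their `θ`-mean by at most `T`. The minimum of the two cloud rates is at
  -- most their `θ`-mean, and the conditional informations then cancel.
  set θ := d₂ / (d₁ + d₂) with hθ
  set T := d₁ * d₂ / (d₁ + d₂) with hT
  have hθ0 : 0 ≤ θ := by positivity
  have hθ1 : 0 ≤ 1 - θ := by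
    rw [hθ, sub_nonneg]; exact div_le_one_of_le₀ (by linarith) hd.le
  have hT1 : θ * d₁ = T := by rw [hθ, hT]; ring
  have hT2 : (1 - θ) * d₂ = T := by rw [hθ, hT]; field_simp; ring
  have key : ∀ w, martonSum F₁ F₂ (fun u v x => q (u, v, w, x))
      ≤ θ * chInfo F₁ (∑ u, ∑ v, q (u, v, w, 0)) (∑ u, ∑ v, q (u, v, w, 1))
        + (1 - θ) * chInfo F₂ (∑ u, ∑ v, q (u, v, w, 0)) (∑ u, ∑ v, q (u, v, w, 1))
        + (∑ u, ∑ v, q (u, v, w, 0) + ∑ u, ∑ v, q (u, v, w, 1)) * T := by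
    intro w
    refine (martonSumBounded (q := fun u v x => q (u, v, w, x)) s₁ s₂ fun u v x => hq _).trans ?_
    have c1 := mul_le_mul_of_nonneg_left
      (chInfo_sub_le_of_inputInfo_sub_le hD₁ (hm w 0) (hm w 1)) hθ0
    have c2 := mul_le_mul_of_nonneg_left
      (chInfo_sub_le_of_inputInfo_sub_le hD₂ (hm w 0) (hm w 1)) hθ1
    rw [mul_left_comm, hT1] at c1
    rw [mul_left_comm, hT2] at c2
    refine max_le ?_ ?_ <;> linarith
  have hsum := sum_le_sum fun w (_ : w ∈ univ) => key w
  simp only [sum_add_distrib, ← mul_sum, ← sum_mul] at hsum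
  rw [hM1, one_mul] at hsum
  set A₁ := ∑ w, chInfo F₁ (∑ u, ∑ v, q (u, v, w, 0)) (∑ u, ∑ v, q (u, v, w, 1))
  set A₂ := ∑ w, chInfo F₂ (∑ u, ∑ v, q (u, v, w, 0)) (∑ u, ∑ v, q (u, v, w, 1))
  set B₁ := chInfo F₁ (∑ w, ∑ u, ∑ v, q (u, v, w, 0)) (∑ w, ∑ u, ∑ v, q (u, v, w, 1))
  set B₂ := chInfo F₂ (∑ w, ∑ u, ∑ v, q (u, v, w, 0)) (∑ w, ∑ u, ∑ v, q (u, v, w, 1))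
  have m1 := mul_le_mul_of_nonneg_left (min_le_left (B₁ - A₁) (B₂ - A₂)) hθ0
  have m2 := mul_le_mul_of_nonneg_left (min_le_right (B₁ - A₁) (B₂ - A₂)) hθ1
  have n1 := mul_le_mul_of_nonneg_left b1 hθ0
  have n2 := mul_le_mul_of_nonneg_left b2 hθ1
  linarith

/-- Randomized time division: with probability `α` a cloud centre connected to `X` by `BSC(t₁)`
and a satellite for the second receiver, otherwise a cloud centre connected to `X` by `BSC(t₂)` and
a satellite for the first receiver. -/
lemma mem_martonInnerBound_of_randomized_timeDivision
    (s₁ : ∀ a b, chInfo F₁ a b = chInfo F₁ b a) (s₂ : ∀ a b, chInfo F₂ a b = chInfo F₂ b a)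
    {C α t₁ t₂ : ℝ} (h₁ : chInfo F₁ (1 / 2) (1 / 2) = C) (h₂ : chInfo F₂ (1 / 2) (1 / 2) = C)
    (hα : α ∈ Set.Icc (0 : ℝ) 1) (ht₁ : t₁ ∈ Set.Icc (0 : ℝ) 1) (ht₂ : t₂ ∈ Set.Icc (0 : ℝ) 1)
    {R : ℝ × ℝ} (hR1 : 0 ≤ R.1) (hR2 : 0 ≤ R.2) (h3 : R.1 ≤ C - α * inputInfo F₁ t₁)
    (h4 : R.2 ≤ C - (1 - α) * inputInfo F₂ t₂)
    (h5 : R.1 + R.2 ≤ C + α * (inputInfo F₂ t₁ - inputInfo F₁ t₁))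
    (h6 : R.1 + R.2 ≤ C + (1 - α) * (inputInfo F₁ t₂ - inputInfo F₂ t₂)) :
    R ∈ martonInnerBound F₁ F₂ := by
  -- `W` consists of the branch and the cloud bit. In the first branch `U` is constant and `V = X`;
  -- in the second the roles are exchanged.
  set q : Fin 2 × Fin 2 → Fin 2 → Fin 2 → Fin 2 → ℝ := fun w u v x =>
    if w.1 = 0 then (if u = 0 ∧ v = x then α / 2 * (if x = w.2 then 1 - t₁ else t₁) else 0)
    else (if v = 0 ∧ u = x then (1 - α) / 2 * (if x = w.2 then 1 - t₂ else t₂) else 0) with hq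
  have hα' : 0 ≤ α / 2 := by linarith [hα.1]
  have hβ' : 0 ≤ (1 - α) / 2 := by linarith [hα.2]
  have hq0 : ∀ w u v x, 0 ≤ q w u v x := by
    intro w u v x
    simp only [hq]
    split_ifs
    · exact mul_nonneg hα' (by linarith [ht₁.2])
    · exact mul_nonneg hα' ht₁.1
    · exact le_rfl
    · exact mul_nonneg hβ' (by linarith [ht₂.2])
    · exact mul_nonneg hβ' ht₂.1
    · exact le_rfl
  have hM : ∀ x, ∑ w, ∑ u, ∑ v, q w u v x = 1 / 2 := by
    intro x
    fin_cases x <;> simp [hq, Fintype.sum_prod_type, Fin.sum_univ_two] <;> ring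
  have hq1 : ∑ u, ∑ v, ∑ w, ∑ x, q w u v x = 1 := by
    have h := hM 0
    have h' := hM 1
    rw [sum_rotate fun u v w => ∑ x, q w u v x]
    simp only [Fin.sum_univ_two (f := fun x => q _ _ _ x), sum_add_distrib]
    rw [h, h']; norm_num
  have e1 : ∀ {𝒴 : Type} [Fintype 𝒴] (F : DMC (Fin 2) 𝒴), (∀ a b, chInfo F a b = chInfo F b a) →
      ∀ c t, chInfo F (c / 2 * (1 - t)) (c / 2 * t) + chInfo F (c / 2 * t) (c / 2 * (1 - t))
        = c * inputInfo F t := by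
    intro 𝒴 _ F s c t
    rw [s (c / 2 * t), chInfo_mul, inputInfo]; ring
  have hcloud : ∀ {𝒴 : Type} [Fintype 𝒴] (F : DMC (Fin 2) 𝒴),
      (∀ a b, chInfo F a b = chInfo F b a) →
      ∑ w, chInfo F (∑ u, ∑ v, q w u v 0) (∑ u, ∑ v, q w u v 1)
        = α * inputInfo F t₁ + (1 - α) * inputInfo F t₂ := by
    intro 𝒴 _ F s
    rw [← e1 F s, ← e1 F s]
    simp [hq, Fintype.sum_prod_type, Fin.sum_univ_two]
  have hsum : ∑ w, martonSum F₁ F₂ (q w) = α * inputInfo F₂ t₁ + (1 - α) * inputInfo F₁ t₂ := by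
    rw [← e1 F₂ s₂, ← e1 F₁ s₁]
    have r1 := fun i : Fin 2 => martonSum_row (F₁ := F₁) (F₂ := F₂)
      fun x => α / 2 * (if x = i then 1 - t₁ else t₁)
    have r2 := fun i : Fin 2 => martonSum_col (F₁ := F₁) (F₂ := F₂)
      fun x => (1 - α) / 2 * (if x = i then 1 - t₂ else t₂)
    simp only [hq, Fintype.sum_prod_type, Fin.sum_univ_two, reduceIte, one_ne_zero, r1, r2,
      Fin.isValue, zero_ne_one]
  have hfst : ∑ w, ∑ u, chInfo F₁ (∑ v, q w u v 0) (∑ v, q w u v 1) = α * inputInfo F₁ t₁ := by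
    rw [← e1 F₁ s₁]
    simp [hq, Fintype.sum_prod_type, Fin.sum_univ_two]
  have hsnd : ∑ w, ∑ v, chInfo F₂ (∑ u, q w u v 0) (∑ u, q w u v 1)
      = (1 - α) * inputInfo F₂ t₂ := by
    rw [← e1 F₂ s₂]
    simp [hq, Fintype.sum_prod_type, Fin.sum_univ_two]
  refine mem_martonInnerBound q hq0 hq1 hR1 hR2 ?_ ?_ ?_
  · rwa [hM, hM, h₁, hfst]
  · rwa [hM, hM, h₂, hsnd]
  · rw [hM, hM, h₁, h₂, hcloud F₁ s₁, hcloud F₂ s₂, hsum, ← sub_le_iff_le_add]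
    exact le_min (by linarith) (by linarith)

/-- The outer bound with `U` (resp. `V`) a time-shared mixture of `X` and of the input of a binary
symmetric channel to `X`. -/
lemma mem_outerBound_of_mixture
    (s₁ : ∀ a b, chInfo F₁ a b = chInfo F₁ b a) (s₂ : ∀ a b, chInfo F₂ a b = chInfo F₂ b a)
    {C β γ t₁ t₂ : ℝ} (h₁ : chInfo F₁ (1 / 2) (1 / 2) = C) (h₂ : chInfo F₂ (1 / 2) (1 / 2) = C)
    (hβ : β ∈ Set.Icc (0 : ℝ) 1) (hγ : γ ∈ Set.Icc (0 : ℝ) 1) (ht₁ : t₁ ∈ Set.Icc (0 : ℝ) 1)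
    (ht₂ : t₂ ∈ Set.Icc (0 : ℝ) 1)
    {R : ℝ × ℝ} (hR1 : 0 ≤ R.1) (hR2 : 0 ≤ R.2) (h3 : R.1 ≤ C - β * inputInfo F₁ t₁)
    (h4 : R.2 ≤ C - γ * inputInfo F₂ t₂)
    (h5 : R.1 + R.2 ≤ C + β * (inputInfo F₂ t₁ - inputInfo F₁ t₁))
    (h6 : R.1 + R.2 ≤ C + γ * (inputInfo F₁ t₂ - inputInfo F₂ t₂)) :
    R ∈ outerBound F₁ F₂ := by
  -- The conditional law of the auxiliary variable given `X`: with probability `c` a BSC of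
  -- crossover `t`, otherwise `X` itself, and the choice is revealed.
  set K : ℝ → ℝ → Fin 2 × Fin 2 → Fin 2 → ℝ := fun c t u x =>
    if u.1 = 0 then c * (if x = u.2 then 1 - t else t) else (1 - c) * (if x = u.2 then 1 else 0)
    with hK
  have hK0 : ∀ c t : ℝ, c ∈ Set.Icc (0 : ℝ) 1 → t ∈ Set.Icc (0 : ℝ) 1 → ∀ u x, 0 ≤ K c t u x := by
    intro c t hc ht u x
    simp only [hK]
    split_ifs
    · exact mul_nonneg hc.1 (by linarith [ht.2])
    · exact mul_nonneg hc.1 ht.1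
    · exact mul_nonneg (by linarith [hc.2]) zero_le_one
    · simp
  have hK1 : ∀ c t x, ∑ u, K c t u x = 1 := by
    intro c t x
    fin_cases x <;> simp [hK, Fintype.sum_prod_type, Fin.sum_univ_two] <;> ring
  have hKI : ∀ {𝒴 : Type} [Fintype 𝒴] (F : DMC (Fin 2) 𝒴),
      (∀ a b, chInfo F a b = chInfo F b a) → ∀ c t,
      ∑ u, chInfo F (1 / 2 * K c t u 0) (1 / 2 * K c t u 1) = c * inputInfo F t := by
    intro 𝒴 _ F s c t
    simp only [hK, Fintype.sum_prod_type, Fin.sum_univ_two, reduceIte, one_ne_zero, Fin.isValue,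
      zero_ne_one, chInfo_mul, s t, mul_zero, chInfo_zero_left, chInfo_zero_right, inputInfo]
    ring
  -- `U` and `V` are independent given `X`, so `β` and `γ` are not tied together; in Marton's bound
  -- the branch is shared through `W`.
  set q : Fin 2 × Fin 2 → Fin 2 × Fin 2 → Fin 2 → ℝ := fun u v x =>
    1 / 2 * K β t₁ u x * K γ t₂ v x with hq
  have hrow : ∀ u x, ∑ v, q u v x = 1 / 2 * K β t₁ u x := fun u x => by
    simp only [hq, ← mul_sum, hK1, mul_one]
  have hcol : ∀ v x, ∑ u, q u v x = 1 / 2 * K γ t₂ v x := fun v x => by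
    simp only [hq, mul_right_comm _ (K β t₁ _ _), ← mul_sum, hK1, mul_one]
  have htot : ∀ x, ∑ u, ∑ v, q u v x = 1 / 2 := fun x => by
    simp only [hrow, ← mul_sum, hK1, mul_one]
  refine mem_outerBound q (fun u v x => ?_) ?_ hR1 hR2 ?_ ?_ ?_ ?_
  · exact mul_nonneg (mul_nonneg (by norm_num) (hK0 _ _ hβ ht₁ _ _)) (hK0 _ _ hγ ht₂ _ _)
  · rw [sum_rotate q]
    simp only [htot]; simp
  all_goals rw [htot, htot]
  all_goals simp only [hrow, hcol, h₁, h₂, hKI F₁ s₁, hKI F₂ s₂]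
  · exact h3
  · exact h4
  · linarith
  · linarith

end Pair

open Filter Topology

/-! ### The equivalences -/

lemma exists_rate_pair {A B S C : ℝ} (hA : 0 ≤ A) (hB : 0 ≤ B) (hAS : A ≤ S) (hAB : C < A + B)
    (hS : C < S) : ∃ R : ℝ × ℝ, 0 ≤ R.1 ∧ 0 ≤ R.2 ∧ R.1 ≤ A ∧ R.2 ≤ B ∧ R.1 + R.2 ≤ S ∧
      C < R.1 + R.2 := by
  refine ⟨(A, min B (S - A)), hA, le_min hB (sub_nonneg.2 hAS), le_rfl, min_le_left _ _, ?_, ?_⟩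
  · have := min_le_right B (S - A)
    change A + min B (S - A) ≤ S
    linarith
  · have : C - A < min B (S - A) := lt_min (by linarith) (by linarith)
    change C < A + min B (S - A)
    linarith

section Final

variable {𝒴₁ 𝒴₂ : Type} [Fintype 𝒴₁] [Fintype 𝒴₂]
  {F₁ : DMC (Fin 2) 𝒴₁} {F₂ : DMC (Fin 2) 𝒴₂}

lemma inputInfo_eqOn_of_eventuallyEq (h : ∀ᶠ s in 𝓝[>] (0 : ℝ), inputInfo F₁ s = inputInfo F₂ s) :
    Set.EqOn (inputInfo F₁) (inputInfo F₂) (Set.Ioo 0 1) := by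
  obtain ⟨ε, hε, hsub⟩ := mem_nhdsGT_iff_exists_Ioo_subset.1 h
  have hε' : 0 < min ε 1 := lt_min hε one_pos
  have h1 := min_le_left ε 1
  have h2 := min_le_right ε 1
  refine (analyticOnNhd_inputInfo F₁).eqOn_of_preconnected_of_eventuallyEq
    (analyticOnNhd_inputInfo F₂) isPreconnected_Ioo (z₀ := min ε 1 / 2)
    ⟨by linarith, by linarith⟩ ?_
  exact eventually_of_mem (Ioo_mem_nhds (by linarith) (by linarith)) hsub

/-- By the identity theorem the two curves differ at points arbitrarily close to `0`, where both
tend to `0`. Such a point replaces `a₁` or `a₂`, according to the sign of the difference there; the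
point that is kept has the smaller of its two values strictly below `C`. -/
lemma exists_crossing_pair {C a₁ a₂ : ℝ} (ha₁ : a₁ ∈ Set.Icc (0 : ℝ) (1 / 2))
    (ha₂ : a₂ ∈ Set.Icc (0 : ℝ) (1 / 2)) (hlt₁ : inputInfo F₁ a₁ < inputInfo F₂ a₁)
    (hlt₂ : inputInfo F₂ a₂ < inputInfo F₁ a₂) (hC₁ : inputInfo F₂ a₁ ≤ C)
    (hC₂ : inputInfo F₁ a₂ ≤ C) :
    ∃ b₁ ∈ Set.Icc (0 : ℝ) (1 / 2), inputInfo F₁ b₁ < inputInfo F₂ b₁ ∧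
      ∃ b₂ ∈ Set.Icc (0 : ℝ) (1 / 2), inputInfo F₂ b₂ < inputInfo F₁ b₂ ∧
        inputInfo F₁ b₁ + inputInfo F₂ b₂ < C := by
  have hfreq : ∃ᶠ s in 𝓝[>] (0 : ℝ), inputInfo F₁ s ≠ inputInfo F₂ s := by
    intro h
    simp only [ne_eq, not_not] at h
    have heq := inputInfo_eqOn_of_eventuallyEq h
    rcases ha₁.1.eq_or_lt with h0 | h0
    · rw [← h0, inputInfo_zero, inputInfo_zero] at hlt₁
      exact lt_irrefl _ hlt₁
    · exact hlt₁.ne (heq ⟨h0, by linarith [ha₁.2]⟩)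
  have hev₁ : ∀ᶠ s in 𝓝[>] (0 : ℝ), inputInfo F₁ s < C - inputInfo F₂ a₂ := by
    refine nhdsWithin_le_nhds ((continuous_inputInfo F₁).continuousAt.eventually_lt_const ?_)
    rw [inputInfo_zero]; linarith
  have hev₂ : ∀ᶠ s in 𝓝[>] (0 : ℝ), inputInfo F₂ s < C - inputInfo F₁ a₁ := by
    refine nhdsWithin_le_nhds ((continuous_inputInfo F₂).continuousAt.eventually_lt_const ?_)
    rw [inputInfo_zero]; linarith
  have hev₃ : ∀ᶠ s in 𝓝[>] (0 : ℝ), s ∈ Set.Ioo (0 : ℝ) (1 / 2) :=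
    Ioo_mem_nhdsGT (by norm_num)
  obtain ⟨s, hne, e₁, e₂, hs⟩ := (hfreq.and_eventually (hev₁.and (hev₂.and hev₃))).exists
  have hs' : s ∈ Set.Icc (0 : ℝ) (1 / 2) := ⟨hs.1.le, hs.2.le⟩
  rcases lt_or_gt_of_ne hne with h | h
  · exact ⟨s, hs', h, a₂, ha₂, hlt₂, by linarith⟩
  · exact ⟨a₁, ha₁, hlt₁, s, hs', h, by linarith⟩

variable [DecidableEq 𝒴₁] [DecidableEq 𝒴₂]

lemma exists_mem_martonInnerBound_lt_sum
    (s₁ : ∀ a b, chInfo F₁ a b = chInfo F₁ b a) (s₂ : ∀ a b, chInfo F₂ a b = chInfo F₂ b a)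
    {C : ℝ} (h₁ : chInfo F₁ (1 / 2) (1 / 2) = C) (h₂ : chInfo F₂ (1 / 2) (1 / 2) = C)
    {a₁ a₂ : ℝ} (ha₁ : a₁ ∈ Set.Icc (0 : ℝ) 1)
    (ha₂ : a₂ ∈ Set.Icc (0 : ℝ) 1) (hlt₁ : inputInfo F₁ a₁ < inputInfo F₂ a₁)
    (hlt₂ : inputInfo F₂ a₂ < inputInfo F₁ a₂) :
    ∃ R ∈ martonInnerBound F₁ F₂, C < R.1 + R.2 := by
  have c₁ := inputInfo_le s₁ ha₂
  have c₂ := inputInfo_le s₂ ha₁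
  rw [h₁] at c₁
  rw [h₂] at c₂
  have n₁ := inputInfo_nonneg (F := F₁) ha₁
  have n₂ := inputInfo_nonneg (F := F₂) ha₂
  obtain ⟨R, r1, r2, r3, r4, r5, r6⟩ := exists_rate_pair (A := C - 1 / 2 * inputInfo F₁ a₁)
    (B := C - (1 - 1 / 2) * inputInfo F₂ a₂)
    (S := min (C + 1 / 2 * (inputInfo F₂ a₁ - inputInfo F₁ a₁))
      (C + (1 - 1 / 2) * (inputInfo F₁ a₂ - inputInfo F₂ a₂))) (C := C)
    (by linarith) (by linarith) (le_min (by linarith) (by linarith)) (by linarith)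
    (lt_min (by linarith) (by linarith))
  exact ⟨R, mem_martonInnerBound_of_randomized_timeDivision s₁ s₂ h₁ h₂
    ⟨by norm_num, by norm_num⟩ ha₁ ha₂ r1 r2 r3 r4 (r5.trans (min_le_left _ _))
    (r5.trans (min_le_right _ _)), r6⟩

lemma exists_mem_outerBound_notMem_martonInnerBound
    (s₁ : ∀ a b, chInfo F₁ a b = chInfo F₁ b a) (s₂ : ∀ a b, chInfo F₂ a b = chInfo F₂ b a)
    {C : ℝ} (h₁ : chInfo F₁ (1 / 2) (1 / 2) = C) (h₂ : chInfo F₂ (1 / 2) (1 / 2) = C)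
    {a₁ a₂ : ℝ} (ha₁ : a₁ ∈ Set.Icc (0 : ℝ) 1)
    (ha₂ : a₂ ∈ Set.Icc (0 : ℝ) 1) (hlt₁ : inputInfo F₁ a₁ < inputInfo F₂ a₁)
    (hlt₂ : inputInfo F₂ a₂ < inputInfo F₁ a₂) :
    ∃ R ∈ outerBound F₁ F₂, R ∉ martonInnerBound F₁ F₂ := by
  have k₁ := continuous_inputInfo F₁
  have k₂ := continuous_inputInfo F₂
  obtain ⟨t₁, ht₁, hmax₁⟩ := (isCompact_Icc (a := (0 : ℝ)) (b := 1)).exists_isMaxOn ⟨a₁, ha₁⟩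
    (k₂.sub k₁).continuousOn
  obtain ⟨t₂, ht₂, hmax₂⟩ := (isCompact_Icc (a := (0 : ℝ)) (b := 1)).exists_isMaxOn ⟨a₂, ha₂⟩
    (k₁.sub k₂).continuousOn
  obtain ⟨d₁, hd₁⟩ : ∃ d, d = inputInfo F₂ t₁ - inputInfo F₁ t₁ := ⟨_, rfl⟩
  obtain ⟨d₂, hd₂⟩ : ∃ d, d = inputInfo F₁ t₂ - inputInfo F₂ t₂ := ⟨_, rfl⟩
  have hD₁ : ∀ s ∈ Set.Icc (0 : ℝ) 1, inputInfo F₂ s - inputInfo F₁ s ≤ d₁ := fun s hs =>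
    (hmax₁ hs).trans_eq hd₁.symm
  have hD₂ : ∀ s ∈ Set.Icc (0 : ℝ) 1, inputInfo F₁ s - inputInfo F₂ s ≤ d₂ := fun s hs =>
    (hmax₂ hs).trans_eq hd₂.symm
  have hd₁0 : 0 < d₁ := by linarith [hD₁ a₁ ha₁]
  have hd₂0 : 0 < d₂ := by linarith [hD₂ a₂ ha₂]
  have c₁ := inputInfo_le s₁ ht₂
  have c₂ := inputInfo_le s₂ ht₁
  rw [h₁] at c₁
  rw [h₂] at c₂
  have n₁ := inputInfo_nonneg (F := F₁) ht₁
  have n₂ := inputInfo_nonneg (F := F₂) ht₂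
  have hC : 0 < C := by linarith
  have hd : 0 < d₁ + d₂ := add_pos hd₁0 hd₂0
  obtain ⟨T, hT⟩ : ∃ T, T = d₁ * d₂ / (d₁ + d₂) := ⟨_, rfl⟩
  have hT0 : 0 < T := hT ▸ by positivity
  -- With `ε = 0` the weights `β`, `γ` add up to one and both sum constraints equal `C + T`. Any `ε
  -- > 0` lifts them above it; this one costs the individual rate bounds only `2 * ε * C = T / 2`,
  -- which leaves their sum above `C + T`.
  obtain ⟨ε, hε⟩ : ∃ ε, ε = T / (4 * C) := ⟨_, rfl⟩
  have hε0 : 0 < ε := hε ▸ by positivity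
  have hεC : ε * C = T / 4 := by rw [hε]; field_simp
  obtain ⟨β, hβ⟩ : ∃ β, β = d₂ / (d₁ + d₂) + ε := ⟨_, rfl⟩
  obtain ⟨γ, hγ⟩ : ∃ γ, γ = d₁ / (d₁ + d₂) + ε := ⟨_, rfl⟩
  have hsum : d₂ / (d₁ + d₂) + d₁ / (d₁ + d₂) = 1 := by field_simp; ring
  have hβd : β * d₁ = T + ε * d₁ := by rw [hβ, hT]; ring
  have hγd : γ * d₂ = T + ε * d₂ := by rw [hγ, hT]; ring
  have hε₁ : ε ≤ d₁ / (d₁ + d₂) := by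
    have h : T = d₁ / (d₁ + d₂) * d₂ := by rw [hT]; ring
    rw [hε, h, div_le_iff₀ (by positivity)]
    exact mul_le_mul_of_nonneg_left (by linarith) (by positivity)
  have hε₂ : ε ≤ d₂ / (d₁ + d₂) := by
    have h : T = d₂ / (d₁ + d₂) * d₁ := by rw [hT]; ring
    rw [hε, h, div_le_iff₀ (by positivity)]
    exact mul_le_mul_of_nonneg_left (by linarith) (by positivity)
  have hβI : β ∈ Set.Icc (0 : ℝ) 1 := ⟨by rw [hβ]; positivity, by linarith⟩
  have hγI : γ ∈ Set.Icc (0 : ℝ) 1 := ⟨by rw [hγ]; positivity, by linarith⟩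
  have p₁ := mul_le_mul_of_nonneg_left c₂ hβI.1
  have p₂ := mul_le_mul_of_nonneg_left c₁ hγI.1
  have q₁ : β * inputInfo F₁ t₁ = β * inputInfo F₂ t₁ - β * d₁ := by rw [hd₁]; ring
  have q₂ : γ * inputInfo F₂ t₂ = γ * inputInfo F₁ t₂ - γ * d₂ := by rw [hd₂]; ring
  have r₁ := mul_nonneg hβI.1 n₁
  have r₂ := mul_nonneg hγI.1 n₂
  have hε₃ := mul_pos hε0 hd₁0
  have hε₄ := mul_pos hε0 hd₂0
  have hβC := mul_le_mul_of_nonneg_right hβI.2 hC.le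
  have hγC := mul_le_mul_of_nonneg_right hγI.2 hC.le
  have hβγ : β * C + γ * C = C + T / 2 := by
    have : β + γ = 1 + 2 * ε := by linarith
    rw [← add_mul, this]; linarith
  obtain ⟨R, v1, v2, v3, v4, v5, v6⟩ := exists_rate_pair (A := C - β * inputInfo F₁ t₁)
    (B := C - γ * inputInfo F₂ t₂) (S := min (C + β * d₁) (C + γ * d₂)) (C := C + T)
    (by linarith) (by linarith) (le_min (by linarith) (by linarith)) (by linarith)
    (lt_min (by linarith) (by linarith))
  refine ⟨R, mem_outerBound_of_mixture s₁ s₂ h₁ h₂ hβI hγI ht₁ ht₂ v1 v2 v3 v4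
    (hd₁ ▸ v5.trans (min_le_left _ _)) (hd₂ ▸ v5.trans (min_le_right _ _)), fun hR => ?_⟩
  have := sum_le_of_mem_martonInnerBound s₁ s₂ h₁ h₂ hd₁0 hd₂0 hD₁ hD₂ hR
  rw [← hT] at this
  linarith

end Final

end BroadcastBISO

theorem mainTheorem2 (l₁ l₂ : ℕ)
    (F₁ : BroadcastBISO.DMC (Fin 2) (BroadcastBISO.SymAlphabet l₁))
    (F₂ : BroadcastBISO.DMC (Fin 2) (BroadcastBISO.SymAlphabet l₂))
    (hF₁ : F₁.IsBISO) (hF₂ : F₂.IsBISO)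
    (C : ℝ) (hC₁ : F₁.capacity = C) (hC₂ : F₂.capacity = C) :
    List.TFAE
      [¬ BroadcastBISO.MoreCapableComparable F₁ F₂,
       BroadcastBISO.timeDivision F₁ F₂ ⊂ BroadcastBISO.outerBound F₁ F₂,
       ∃ s₁ ∈ {s : ℝ | s ∈ Set.Icc 0 (1 / 2) ∧
            BroadcastBISO.bscInfo F₁ s > BroadcastBISO.bscInfo F₂ s},
         ∃ s₂ ∈ {s : ℝ | s ∈ Set.Icc 0 (1 / 2) ∧
            BroadcastBISO.bscInfo F₁ s < BroadcastBISO.bscInfo F₂ s},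
           BroadcastBISO.bscInfo F₁ s₁ + BroadcastBISO.bscInfo F₂ s₂ > C,
       BroadcastBISO.timeDivision F₁ F₂ ⊂ BroadcastBISO.martonInnerBound F₁ F₂,
       BroadcastBISO.martonInnerBound F₁ F₂ ⊂ BroadcastBISO.outerBound F₁ F₂] := by
  open BroadcastBISO in
  have s₁ := chInfo_comm_of_isBISO hF₁
  have s₂ := chInfo_comm_of_isBISO hF₂
  have h₁ : chInfo F₁ (1 / 2) (1 / 2) = C := by rw [← capacity_eq s₁, hC₁]
  have h₂ : chInfo F₂ (1 / 2) (1 / 2) = C := by rw [← capacity_eq s₂, hC₂]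
  have b₁ : ∀ t, bscInfo F₁ t = C - inputInfo F₁ t := fun t => by rw [bscInfo_eq s₁, h₁, inputInfo]
  have b₂ : ∀ t, bscInfo F₂ t = C - inputInfo F₂ t := fun t => by rw [bscInfo_eq s₂, h₂, inputInfo]
  have half : (1 / 2 : ℝ) ∈ Set.Icc (0 : ℝ) 1 := ⟨by norm_num, by norm_num⟩
  have widen : ∀ {a : ℝ}, a ∈ Set.Icc (0 : ℝ) (1 / 2) → a ∈ Set.Icc (0 : ℝ) 1 := fun h =>
    ⟨h.1, by linarith [h.2]⟩
  have hTM : timeDivision F₁ F₂ ⊆ martonInnerBound F₁ F₂ := by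
    rintro R ⟨hR1, hR2, α, hα, r1, r2⟩
    rw [hC₁] at r1
    rw [hC₂] at r2
    -- At crossover `1 / 2` the cloud bit carries nothing, and plain time division is recovered.
    refine mem_martonInnerBound_of_randomized_timeDivision s₁ s₂ (α := 1 - α) h₁ h₂
      ⟨by linarith [hα.2], by linarith [hα.1]⟩ half half hR1 hR2 ?_ ?_ ?_ ?_
    all_goals simp only [inputInfo_half, h₁, h₂]
    all_goals linarith
  have hMO := martonInnerBound_subset_outerBound F₁ F₂
  have hcross : ¬ MoreCapableComparable F₁ F₂ → ∃ a₁ ∈ Set.Icc (0 : ℝ) (1 / 2),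
      ∃ a₂ ∈ Set.Icc (0 : ℝ) (1 / 2), inputInfo F₁ a₁ < inputInfo F₂ a₁ ∧
        inputInfo F₂ a₂ < inputInfo F₁ a₂ := by
    intro h
    rw [MoreCapableComparable, moreCapable_iff s₁ s₂, moreCapable_iff s₂ s₁, not_or] at h
    push Not at h
    obtain ⟨⟨a₁, ha₁, e₁⟩, a₂, ha₂, e₂⟩ := h
    exact ⟨a₁, ha₁, a₂, ha₂, e₁, e₂⟩
  have hOT : MoreCapableComparable F₁ F₂ → outerBound F₁ F₂ ⊆ timeDivision F₁ F₂ := fun h R hR =>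
    (mem_timeDivision hC₁ hC₂).2
      ⟨hR.1, hR.2.1, sum_le_of_mem_outerBound s₁ s₂ h₁ h₂ h hR⟩
  tfae_have 1 → 3 := by
    intro h
    obtain ⟨a₁, ha₁, a₂, ha₂, e₁, e₂⟩ := hcross h
    obtain ⟨c₁, hc₁, l₁, c₂, hc₂, l₂, hlt⟩ := exists_crossing_pair ha₁ ha₂ e₁ e₂
      ((inputInfo_le s₂ (widen ha₁)).trans_eq h₂) ((inputInfo_le s₁ (widen ha₂)).trans_eq h₁)
    refine ⟨c₁, ⟨hc₁, ?_⟩, c₂, ⟨hc₂, ?_⟩, ?_⟩ <;> rw [b₁, b₂] <;> linarith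
  tfae_have 3 → 1 := by
    rintro ⟨c₁, ⟨hc₁, l₁⟩, c₂, ⟨hc₂, l₂⟩, -⟩ h
    rw [b₁, b₂] at l₁ l₂
    rw [MoreCapableComparable, moreCapable_iff s₁ s₂, moreCapable_iff s₂ s₁] at h
    rcases h with h | h
    · linarith [h c₁ hc₁]
    · linarith [h c₂ hc₂]
  tfae_have 1 → 4 := by
    intro h
    obtain ⟨a₁, ha₁, a₂, ha₂, e₁, e₂⟩ := hcross h
    obtain ⟨R, hR, hlt⟩ := exists_mem_martonInnerBound_lt_sum s₁ s₂ h₁ h₂ (widen ha₁) (widen ha₂) e₁ e₂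
    exact ⟨hTM, fun hsub => absurd ((mem_timeDivision hC₁ hC₂).1 (hsub hR)).2.2 (not_le.2 hlt)⟩
  tfae_have 4 → 2 := fun h => h.trans_subset hMO
  tfae_have 2 → 1 := fun h hcomp => h.2 (hOT hcomp)
  tfae_have 1 → 5 := by
    intro h
    obtain ⟨a₁, ha₁, a₂, ha₂, e₁, e₂⟩ := hcross h
    obtain ⟨R, hR, hRn⟩ :=
      exists_mem_outerBound_notMem_martonInnerBound s₁ s₂ h₁ h₂ (widen ha₁) (widen ha₂) e₁ e₂
    exact ⟨hMO, fun hsub => hRn (hsub hR)⟩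
  tfae_have 5 → 1 := fun h hcomp => h.2 ((hOT hcomp).trans hTM)
  tfae_finish
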